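/- Let $G$ be a finitely generated nilpotent group of class $c$ whose last nontrivial lower central term $\gamma_c(G)$ (where $\gamma_1(G)=G$, $\gamma_{k+1}(G)=[\gamma_k(G),G]$) has finite index in the center $Z(G)$. Let $\dim(G)$ be the Hirsch length of $G$, that is, the number of infinite cyclic factors in a refinement of the upper central series of $G$ with cyclic factors. For a finite generating set $X$ of $G$ let $\Phi_G^X(n)$ be the minimal order of a finite group $Q$ for which there is a homomorphism $G\to Q$ that is injective on the closed ball of radius $n$ about $1$ in the word metric of $G$ with respect to $X$. Then for every finite generating set $X$, $$\Phi_G^X(n)\approx n^{c\cdot\dim(G)},$$ where $f\approx g$ means that there is a positive integer $C$ such that $f(n)\le C\,g(Cn)$ and $g(n)\le C\,f(Cn)$ for all integers $n\ge 1$. -/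

import Mathlib

namespace FullRF

universe u

/-- The closed ball of radius `n` about `1` in the word metric of `G` given by `X`: the elements
that are products of at most `n` factors from `X ∪ X⁻¹`. -/
def wordBall {G : Type u} [Group G] (X : Set G) (n : ℕ) : Set G :=
  {g | ∃ l : List G, l.length ≤ n ∧ (∀ x ∈ l, x ∈ X ∨ x⁻¹ ∈ X) ∧ l.prod = g}

/-- A subset `S` of `G` is fully detected by the group `Q` if some homomorphism `G → Q` is
injective on `S`. -/
def FullyDetects {G : Type u} [Group G] (S : Set G) (Q : Type) [Group Q] : Prop :=
  ∃ φ : G →* Q, Set.InjOn φ S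

/-- The minimal order of a finite group that fully detects the ball of radius `n`. (If there is no
such finite group the value is `0`; this does not happen when `G` is residually finite and `X` is
finite.) -/
noncomputable def fullGrowth {G : Type u} [Group G] (X : Set G) (n : ℕ) : ℕ :=
  sInf {m : ℕ | ∃ (Q : Type) (_ : Group Q), Finite Q ∧ FullyDetects (wordBall X n) Q ∧
    Nat.card Q = m}

/-- `f ≼ g`: there is a constant `C` with `f n ≤ C * g (C * n)` for all positive integers `n`. -/
def GrowthLE (f g : ℕ → ℕ) : Prop :=
  ∃ C : ℕ, 0 < C ∧ ∀ n : ℕ, 0 < n → f n ≤ C * g (C * n)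

/-- Equivalence of growth functions. -/
def GrowthEquiv (f g : ℕ → ℕ) : Prop :=
  GrowthLE f g ∧ GrowthLE g f

/-- `S 0 ≥ S 1 ≥ ⋯ ≥ S n` is a series from `G` down to `1` that refines the upper central series
of `G` and has cyclic factors `S i / S (i + 1)`. -/
structure IsCyclicCentralRefinement (G : Type u) [Group G] (n : ℕ)
    (S : Fin (n + 1) → Subgroup G) : Prop where
  antitone : Antitone S
  first : S 0 = ⊤
  last : S (Fin.last n) = ⊥
  /-- Every term of the upper central series occurs in the series. -/
  refines : ∀ k : ℕ, ∃ i, S i = Subgroup.upperCentralSeries G k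
  /-- Automatic for a refinement of a central series. -/
  normal : ∀ i, (S i).Normal
  cyclic : ∀ i : Fin n,
    haveI := normal i.succ
    IsCyclic (S i.castSucc ⧸ (S i.succ).subgroupOf (S i.castSucc))

/-- The number of infinite factors of a finite series of subgroups. -/
noncomputable def numInfiniteFactors {G : Type u} [Group G] {n : ℕ}
    (S : Fin (n + 1) → Subgroup G) : ℕ :=
  Nat.card {i : Fin n // Infinite (S i.castSucc ⧸ (S i.succ).subgroupOf (S i.castSucc))}

/-- The dimension (Hirsch length) of a finitely generated nilpotent group: the number of infinite
cyclic factors in a refinement of the upper central series with cyclic factors. This number is the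
same for all such refinements, so that the infimum is their common value. -/
noncomputable def dim (G : Type u) [Group G] : ℕ :=
  sInf {d : ℕ | ∃ (n : ℕ) (S : Fin (n + 1) → Subgroup G),
    IsCyclicCentralRefinement G n S ∧ numInfiniteFactors S = d}

/-- The last term `γ_c(G)` of the lower central series of a nilpotent group of class `c`. The series
is indexed by `γ₁(G) = G` on paper and from `0` in Mathlib, whence the `c - 1`. -/
noncomputable def lastLowerCentral (G : Type u) [Group G] : Subgroup G :=
  (⊤ : Subgroup G).lowerCentralSeries (Group.nilpotencyClass G - 1)

end FullRF

/-! Fix a series refining the upper central series with cyclic factors and exactly `dim G` infinite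
ones; let c be the class. Both bounds are proved for this one series, so invariance of the Hirsch
length is never needed.

Upper bound. Weight G by the isolators of its lower central series. A function G → ℤ has degree less
than k if left differences by elements of weight i lower k by i. A polynomial of degree d is O(n^d)
on balls (`PolyOn.growth`), and left translation by a product of powers with exponent m·k! changes
it by a multiple of m (`PolyOn.dvd_sub_of_mem_closure`). Coordinates on the isolator factors extend
to finitely many polynomials of degree at most c on G, zero at 1, whose common zeros are torsion
(`exists_separating_polynomials`). With m just above their values on the ball of radius 2n, about
n^c, the subgroup generated by (m·(c+1)!)-th powers, cut with a torsion-free normal subgroup of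
finite index, meets that ball only in 1. Its index is O(m^dim) (`CyclicData.index_powSubgroup`).

Lower bound. Let φ be injective on a ball of radius O(m). The products of generators of the infinite
factors with exponents below m^c have distinct images. These products may be long, but a discrepancy
between two of them can be moved into the center by iterated commutators
(`exists_centralDetectors`). There, as γ_c has finite index, a fixed power of it is a product of
boundedly many powers with exponents at most m^c. Such powers have length O(m)
(`exists_wordBall_zpow_center`), so φ detects them. -/

namespace FullRF

universe u

open scoped commutatorElement

/-- A central filtration `Γ 1 = G ≥ Γ 2 ≥ ⋯` with `[Γ i, Γ j] ≤ Γ (i + j)`. -/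
structure IsFiltration {G : Type*} [Group G] (Γ : ℕ → Subgroup G) : Prop where
  antitone : Antitone Γ
  one : Γ 1 = ⊤
  normal : ∀ i, (Γ i).Normal
  comm : ∀ i j, ∀ g ∈ Γ i, ∀ h ∈ Γ j, g * h * g⁻¹ * h⁻¹ ∈ Γ (i + j)

/-- The function `f` is a polynomial of degree less than `k` on the subgroup `N`, where elements
of `Γ i` have weight `i`: a left difference by an element of weight `i` lowers the degree by `i`. -/
inductive PolyOn {G : Type*} [Group G] (Γ : ℕ → Subgroup G) (N : Subgroup G) :
    ℕ → (G → ℤ) → Prop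
  | zero {f : G → ℤ} : (∀ x ∈ N, f x = 0) → PolyOn Γ N 0 f
  | succ {k : ℕ} {f : G → ℤ} :
      (∀ i, 1 ≤ i → ∀ g ∈ N, g ∈ Γ i → PolyOn Γ N (k + 1 - i) (fun x => f (g * x) - f x)) →
      PolyOn Γ N (k + 1) f

/-! ### Polynomial functions with respect to a filtration -/

section Poly

variable {G : Type*} [Group G] {Γ : ℕ → Subgroup G} {N : Subgroup G}

theorem PolyOn.eq_zero {f : G → ℤ} (h : PolyOn Γ N 0 f) : ∀ x ∈ N, f x = 0 := by
  cases h; assumption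

theorem PolyOn.diff {k : ℕ} {f : G → ℤ} (h : PolyOn Γ N k f) {i : ℕ} (hi : 1 ≤ i) {g : G}
    (hg : g ∈ N) (hgi : g ∈ Γ i) : PolyOn Γ N (k - i) (fun x => f (g * x) - f x) := by
  cases h with
  | zero h =>
    rw [Nat.zero_sub]
    refine .zero fun x hx => ?_
    rw [h _ (mul_mem hg hx), h x hx, sub_zero]
  | succ h => exact h i hi g hg hgi

theorem PolyOn.of_diff {k : ℕ} (hk : k ≠ 0) {f : G → ℤ}
    (h : ∀ i, 1 ≤ i → ∀ g ∈ N, g ∈ Γ i → PolyOn Γ N (k - i) (fun x => f (g * x) - f x)) :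
    PolyOn Γ N k f := by
  obtain ⟨k, rfl⟩ := Nat.exists_eq_succ_of_ne_zero hk
  exact .succ h

theorem PolyOn.mono {k l : ℕ} {f : G → ℤ} (h : PolyOn Γ N k f) (hkl : k ≤ l) :
    PolyOn Γ N l f := by
  induction l using Nat.strong_induction_on generalizing k f with
  | _ l ih =>
    rcases eq_or_ne l 0 with rfl | hl
    · rwa [Nat.le_zero.mp hkl] at h
    · exact .of_diff hl fun i hi g hg hgi =>
        ih (l - i) (by omega) (h.diff hi hg hgi) (by omega)

theorem PolyOn.congr {k : ℕ} {f f' : G → ℤ} (h : PolyOn Γ N k f) (hf : ∀ x ∈ N, f x = f' x) :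
    PolyOn Γ N k f' := by
  induction k using Nat.strong_induction_on generalizing f f' with
  | _ k ih =>
    rcases eq_or_ne k 0 with rfl | hk
    · exact .zero fun x hx => by rw [← hf x hx, h.eq_zero x hx]
    · exact .of_diff hk fun i hi g hg hgi =>
        ih (k - i) (by omega) (h.diff hi hg hgi) fun x hx => by
          rw [hf x hx, hf _ (mul_mem hg hx)]

theorem PolyOn.add {k : ℕ} {f f' : G → ℤ} (h : PolyOn Γ N k f) (h' : PolyOn Γ N k f') :
    PolyOn Γ N k (fun x => f x + f' x) := by
  induction k using Nat.strong_induction_on generalizing f f' with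
  | _ k ih =>
    rcases eq_or_ne k 0 with rfl | hk
    · exact .zero fun x hx => by rw [h.eq_zero x hx, h'.eq_zero x hx, add_zero]
    · refine .of_diff hk fun i hi g hg hgi => ?_
      refine (ih (k - i) (by omega) (h.diff hi hg hgi) (h'.diff hi hg hgi)).congr fun x _ => ?_
      ring

theorem PolyOn.comp_mul_left (hΓ : Γ 1 = ⊤) {k : ℕ} {f : G → ℤ} (h : PolyOn Γ N k f) {g : G}
    (hg : g ∈ N) : PolyOn Γ N k (fun x => f (g * x)) := by
  have h1 := (h.diff le_rfl hg (by rw [hΓ]; trivial)).mono (Nat.sub_le k 1)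
  exact (h.add h1).congr fun x _ => by ring

theorem PolyOn.comp_conj (hΓ : IsFiltration Γ) {k : ℕ} {f : G → ℤ} (h : PolyOn Γ N k f) {u : G}
    (hu : ∀ x ∈ N, u * x * u⁻¹ ∈ N) : PolyOn Γ N k (fun x => f (u * x * u⁻¹)) := by
  induction k using Nat.strong_induction_on generalizing f with
  | _ k ih =>
    rcases eq_or_ne k 0 with rfl | hk
    · exact .zero fun x hx => h.eq_zero _ (hu x hx)
    · refine .of_diff hk fun i hi g hg hgi => ?_
      refine (ih (k - i) (by omega)
        (h.diff hi (hu g hg) ((hΓ.normal i).conj_mem g hgi u))).congr fun x _ => ?_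
      simp [mul_assoc]

/-- Conjugation by u is left multiplication by [u, x], of weight at least w + 1. Differencing by g
leaves the same expression for the difference of f, plus a difference of f by [u, g], of weight w +
i. -/
theorem PolyOn.comp_conj_sub (hΓ : IsFiltration Γ) {k w : ℕ} {f : G → ℤ}
    (h : PolyOn Γ N k f) {u : G} (hu : ∀ x ∈ N, u * x * u⁻¹ ∈ N) (huw : u ∈ Γ w) :
    PolyOn Γ N (k - w) (fun x => f (u * x * u⁻¹) - f x) := by
  have hcomm : ∀ g ∈ N, u * g * u⁻¹ * g⁻¹ ∈ N := fun g hg => mul_mem (hu g hg) (inv_mem hg)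
  induction k using Nat.strong_induction_on generalizing f with
  | _ k ih =>
    rcases eq_or_ne (k - w) 0 with hkw | hkw
    · rw [hkw]
      refine .zero fun x hx => ?_
      have h1 := h.diff (i := w + 1) (by omega) (hcomm x hx)
        (hΓ.comm w 1 u huw x (by rw [hΓ.one]; trivial))
      rw [show k - (w + 1) = 0 by omega] at h1
      simpa using h1.eq_zero x hx
    · refine .of_diff hkw fun i hi g hg hgi => ?_
      have h1 := ih (k - i) (by omega) (h.diff hi hg hgi)
      have h2 := (((h.diff (i := w + i) (by omega) (hcomm g hg)
        (hΓ.comm w i u huw g hgi)).comp_mul_left hΓ.one hg).comp_conj hΓ hu)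
      rw [show k - i - w = k - w - i by omega] at h1
      rw [show k - (w + i) = k - w - i by omega] at h2
      refine (h1.add h2).congr fun x _ => ?_
      simp only [mul_assoc, inv_mul_cancel_left]
      ring

theorem PolyOn.const {k : ℕ} (hk : k ≠ 0) (a : ℤ) : PolyOn Γ N k (fun _ => a) :=
  .of_diff hk fun _ _ _ _ _ => (PolyOn.zero fun _ _ => sub_self a).mono (Nat.zero_le _)

/-- Polynomials extend from `N` to a subgroup `M = N ⋊ ⟨t⟩`. -/
theorem PolyOn.extend (hΓ : IsFiltration Γ) {M : Subgroup G} (hNM : N ≤ M) {α : G → ℤ}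
    (hα : ∀ x ∈ M, ∀ y ∈ M, α (x * y) = α x + α y) (hN : ∀ x ∈ M, x ∈ N ↔ α x = 0)
    {t : G} (ht : t ∈ M) (hαt : α t = 1) {w : ℕ} (htw : t ∈ Γ w)
    (hMw : ∀ x ∈ M, x ∈ Γ (w + 1) → x ∈ N) {k : ℕ} {f : G → ℤ} (h : PolyOn Γ N k f) :
    PolyOn Γ M k (fun x => f (x * t ^ (-α x))) := by
  have hα1 : α 1 = 0 := by simpa using hα 1 (one_mem _) 1 (one_mem _)
  have hαinv : ∀ x ∈ M, α x⁻¹ = - α x := fun x hx => by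
    have := hα x hx _ (inv_mem hx)
    rw [mul_inv_cancel, hα1] at this
    omega
  have hαpow : ∀ a : ℤ, α (t ^ a) = a := by
    intro a
    induction a using Int.induction_on with
    | zero => simpa using hα1
    | succ n ih => rw [zpow_add, zpow_one, hα _ (zpow_mem ht _) _ ht, ih, hαt]
    | pred n ih =>
      rw [zpow_sub, zpow_one, hα _ (zpow_mem ht _) _ (inv_mem ht), ih, hαinv _ ht, hαt]; ring
  have hred : ∀ x ∈ M, x * t ^ (-α x) ∈ N := fun x hx => by
    rw [hN _ (mul_mem hx (zpow_mem ht _)), hα _ hx _ (zpow_mem ht _), hαpow]; ring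
  have hconj : ∀ u ∈ M, ∀ x ∈ N, u * x * u⁻¹ ∈ N := fun u hu x hx => by
    have hx0 := (hN x (hNM hx)).mp hx
    rw [hN _ (mul_mem (mul_mem hu (hNM hx)) (inv_mem hu)),
      hα _ (mul_mem hu (hNM hx)) _ (inv_mem hu), hα _ hu _ (hNM hx), hαinv _ hu]
    omega
  induction k using Nat.strong_induction_on generalizing f with
  | _ k ih =>
    rcases eq_or_ne k 0 with rfl | hk
    · exact .zero fun x hx => h.eq_zero _ (hred x hx)
    · refine .of_diff hk fun i hi g hg hgi => ?_
      by_cases hiw : i ≤ w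
      · have hgt := hred g hg
        have htm : t ^ α g ∈ M := zpow_mem ht _
        have hti : t ^ α g ∈ Γ w := zpow_mem htw _
        have hgti : g * t ^ (-α g) ∈ Γ i :=
          mul_mem hgi (zpow_mem (hΓ.antitone hiw htw) _)
        have h1 := (h.diff hi hgt hgti).comp_conj hΓ (hconj _ htm)
        have h2 := (h.comp_conj_sub hΓ (hconj _ htm) hti).mono (show k - w ≤ k - i by omega)
        refine (ih (k - i) (by omega) (h1.add h2)).congr fun x hx => ?_
        rw [hα g hg x hx]
        simp only [neg_add, zpow_add, zpow_neg, mul_assoc, inv_mul_cancel_left]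
        have : (t ^ α g)⁻¹ * (t ^ α x)⁻¹ = (t ^ α x)⁻¹ * (t ^ α g)⁻¹ := by
          rw [← mul_inv_rev, ← mul_inv_rev, ← zpow_add, ← zpow_add, add_comm]
        rw [this]
        ring
      · have hgN : g ∈ N := hMw g hg (hΓ.antitone (by omega) hgi)
        refine (ih (k - i) (by omega) (h.diff hi hgN hgi)).congr fun x hx => ?_
        rw [hα g hg x hx, (hN g hg).mp hgN, zero_add, mul_assoc]

end Poly

/-! ### Growth and congruences of polynomial functions -/

section PolyGrowth

variable {G : Type*} [Group G] {Γ : ℕ → Subgroup G}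

/-- Removing one letter of a word changes f by a polynomial of one degree less, bounded by induction
uniformly over the finitely many letters; at most n letters are removed. -/
theorem PolyOn.growth (hΓ : IsFiltration Γ) {X : Set G} (hX : X.Finite) {k : ℕ} {f : G → ℤ}
    (h : PolyOn Γ ⊤ (k + 1) f) :
    ∃ C : ℕ, ∀ n : ℕ, ∀ g ∈ wordBall X n, |f g| ≤ C * (n + 1) ^ k := by
  induction k generalizing f with
  | zero =>
    refine ⟨(f 1).natAbs, fun n g _ => ?_⟩
    have h1 := (h.diff le_rfl (g := g) trivial (by rw [hΓ.one]; trivial)).eq_zero 1 trivial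
    rw [mul_one] at h1
    rw [sub_eq_zero.mp h1]
    simp
  | succ k ih =>
    have hY : {x | x ∈ X ∨ x⁻¹ ∈ X}.Finite := hX.union (hX.preimage inv_injective.injOn)
    have h1 : ∀ x : G, ∃ C : ℕ, ∀ n : ℕ, ∀ g ∈ wordBall X n,
        |f (x * g) - f g| ≤ C * (n + 1) ^ k := fun x =>
      ih (h.diff le_rfl (g := x) trivial (by rw [hΓ.one]; trivial))
    choose C hC using h1
    have hCle : ∀ x, (x ∈ X ∨ x⁻¹ ∈ X) → C x ≤ ∑ y ∈ hY.toFinset, C y := fun x hx =>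
      Finset.single_le_sum (f := C) (fun _ _ => Nat.zero_le _) (by simpa using hx)
    set D := ∑ y ∈ hY.toFinset, C y
    refine ⟨(f 1).natAbs + D, fun n g ⟨l, hl, hlX, hg⟩ => ?_⟩
    have key : ∀ l : List G, l.length ≤ n → (∀ x ∈ l, x ∈ X ∨ x⁻¹ ∈ X) →
        |f l.prod| ≤ |f 1| + l.length * (D * (n + 1) ^ k) := by
      intro l
      induction l with
      | nil => intro _ _; simp
      | cons x l ihl =>
        intro hl hlX
        have h2 := ihl (by simp at hl; omega) fun y hy => hlX y (by simp [hy])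
        have h3 := hC x n l.prod ⟨l, by simp at hl; omega, fun y hy => hlX y (by simp [hy]), rfl⟩
        have h4 : (C x : ℤ) * (n + 1) ^ k ≤ D * (n + 1) ^ k := by
          have := hCle x (hlX x (by simp))
          gcongr
        rw [List.prod_cons, List.length_cons]
        have h5 : |f (x * l.prod)| ≤ |f (x * l.prod) - f l.prod| + |f l.prod| := by
          simpa using abs_add_le (f (x * l.prod) - f l.prod) (f l.prod)
        push_cast
        linarith
    have h2 := key l hl hlX
    rw [hg] at h2
    have h3 : (l.length : ℤ) ≤ n + 1 := by exact_mod_cast hl.trans (Nat.le_succ n)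
    have h4 : (1 : ℤ) ≤ (n + 1) ^ (k + 1) := one_le_pow₀ (by omega)
    calc |f g| ≤ |f 1| + l.length * (D * (n + 1) ^ k) := h2
      _ ≤ |f 1| * (n + 1) ^ (k + 1) + (n + 1) * (D * (n + 1) ^ k) := by
        gcongr
        exact le_mul_of_one_le_right (abs_nonneg _) h4
      _ = _ := by push_cast; ring

/-- From j·C(M, j) = M·C(M - 1, j - 1) with M = m·k!, where j divides k!. -/
theorem dvd_choose_mul_factorial (m k j : ℕ) (hj : j ≠ 0) (hjk : j ≤ k) :
    m ∣ (m * k.factorial).choose j := by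
  obtain ⟨j, rfl⟩ := Nat.exists_eq_succ_of_ne_zero hj
  rcases Nat.eq_zero_or_pos m with rfl | hm
  · simp
  obtain ⟨q, hq⟩ := Nat.dvd_factorial (Nat.succ_pos j) hjk
  obtain ⟨M, hM⟩ := Nat.exists_eq_succ_of_ne_zero
    (Nat.mul_pos hm k.factorial_pos).ne'
  have h1 := Nat.add_one_mul_choose_eq M j
  rw [← Nat.succ_eq_add_one M, ← hM, hq] at h1
  rw [hq]
  refine ⟨q * M.choose j, ?_⟩
  refine Nat.eq_of_mul_eq_mul_right (Nat.succ_pos j) ?_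
  rw [Nat.succ_eq_add_one] at *
  rw [← h1]
  ring

theorem PolyOn.iterate_fwdDiff (hΓ : IsFiltration Γ) (g x : G) {k : ℕ} {f : G → ℤ}
    (h : PolyOn Γ ⊤ k f) {j : ℕ} (hj : k ≤ j) (n : ℕ) :
    (fwdDiff 1)^[j] (fun n : ℕ => f (g ^ n * x)) n = 0 := by
  induction j generalizing k f n with
  | zero =>
    rw [Nat.le_zero.mp hj] at h
    exact h.eq_zero _ trivial
  | succ j ih =>
    rw [Function.iterate_succ_apply]
    have h1 := ih (h.diff le_rfl (g := g) trivial (by rw [hΓ.one]; trivial))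
      (by omega) n
    have h2 : (fwdDiff 1 fun n : ℕ => f (g ^ n * x)) =
        fun n : ℕ => f (g * (g ^ n * x)) - f (g ^ n * x) := by
      funext n
      simp only [fwdDiff, pow_succ', mul_assoc]
    rw [h2, h1]

/-- Along n ↦ g^n x the function is an integer-valued polynomial of degree less than k. In its
Newton expansion the terms of positive order below k have binomial coefficients divisible by m, and
those of order at least k vanish. -/
theorem PolyOn.dvd_pow_sub (hΓ : IsFiltration Γ) {k : ℕ} {f : G → ℤ} (h : PolyOn Γ ⊤ k f)
    (m : ℕ) (g x : G) : (m : ℤ) ∣ f (g ^ (m * k.factorial) * x) - f x := by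
  have h1 := shift_eq_sum_fwdDiff_iter 1 (fun n : ℕ => f (g ^ n * x)) (m * k.factorial) 0
  rw [Finset.sum_range_succ'] at h1
  simp only [smul_eq_mul, mul_one, zero_add, pow_zero, one_mul, Function.iterate_zero, id,
    Nat.choose_zero_right, one_smul] at h1
  rw [h1, add_sub_cancel_right]
  refine Finset.dvd_sum fun j _ => ?_
  by_cases hj : k ≤ j + 1
  · rw [h.iterate_fwdDiff hΓ g x hj 0, smul_zero]
    exact dvd_zero _
  · rw [nsmul_eq_mul]
    exact Dvd.dvd.mul_right
      (by exact_mod_cast dvd_choose_mul_factorial m k (j + 1) (by omega) (by omega)) _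

theorem PolyOn.dvd_sub_of_mem_closure (hΓ : IsFiltration Γ) {k : ℕ} {f : G → ℤ}
    (h : PolyOn Γ ⊤ k f) (m : ℕ) {u : G}
    (hu : u ∈ Subgroup.closure (Set.range fun g : G => g ^ (m * k.factorial))) (x : G) :
    (m : ℤ) ∣ f (u * x) - f x := by
  induction hu using Subgroup.closure_induction generalizing x with
  | mem u hu =>
    obtain ⟨g, rfl⟩ := hu
    exact h.dvd_pow_sub hΓ m g x
  | one => simp
  | mul u v _ _ hu hv =>
    have := dvd_add (hu (v * x)) (hv x)
    rwa [sub_add_sub_cancel, ← mul_assoc] at this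
  | inv u _ hu =>
    have := hu (u⁻¹ * x)
    rw [mul_inv_cancel_left] at this
    exact (dvd_sub_comm).mp this

end PolyGrowth

/-! ### Commutator identities modulo a normal subgroup -/

section Commutators

variable {G : Type*} [Group G]

theorem commutatorElement_pow_left {a b : G} (h : Commute ⁅a, b⁆ a) (k : ℕ) :
    ⁅a ^ k, b⁆ = ⁅a, b⁆ ^ k := by
  induction k with
  | zero => simp
  | succ k ih =>
    rw [pow_succ' a, commutatorElement_mul_left_eq_conj_mul, ih, (h.pow_left k).symm.eq,
      mul_inv_cancel_right, pow_succ]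

theorem commutatorElement_pow_right {a b : G} (h : Commute ⁅a, b⁆ b) (k : ℕ) :
    ⁅a, b ^ k⁆ = ⁅a, b⁆ ^ k := by
  rw [← inv_inj, commutatorElement_inv, commutatorElement_pow_left, ← commutatorElement_inv a b,
    inv_pow]
  rw [← commutatorElement_inv]
  exact h.inv_left

theorem commutatorElement_pow_pow {a b : G} (h : ∀ x, Commute ⁅a, b⁆ x) (k l : ℕ) :
    ⁅a ^ k, b ^ l⁆ = ⁅a, b⁆ ^ (k * l) := by
  have h1 : ⁅a, b ^ l⁆ = ⁅a, b⁆ ^ l := commutatorElement_pow_right (h b) l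
  rw [commutatorElement_pow_left, h1, ← pow_mul, mul_comm]
  rw [h1]
  exact (h a).pow_left l

theorem mem_of_mk_eq_one {N : Subgroup G} [N.Normal] {x : G} (h : (x : G ⧸ N) = 1) : x ∈ N :=
  (QuotientGroup.eq_one_iff x).mp h

theorem mk_eq_one_of_mem {N : Subgroup G} [N.Normal] {x : G} (h : x ∈ N) : (x : G ⧸ N) = 1 :=
  (QuotientGroup.eq_one_iff x).mpr h

theorem mk_commutatorElement (N : Subgroup G) [N.Normal] (a b : G) :
    ((⁅a, b⁆ : G) : G ⧸ N) = ⁅(a : G ⧸ N), (b : G ⧸ N)⁆ :=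
  map_commutatorElement (QuotientGroup.mk' N) a b

theorem mk_commute {N : Subgroup G} [N.Normal] {a b : G} (h : ⁅a, b⁆ ∈ N) :
    Commute (a : G ⧸ N) (b : G ⧸ N) := by
  rw [← commutatorElement_eq_one_iff_commute, ← mk_commutatorElement]
  exact mk_eq_one_of_mem h

theorem mul_pow_mem_of_commutator_mem {N : Subgroup G} [N.Normal] {a b : G} (h : ⁅a, b⁆ ∈ N)
    {k l : ℕ} (ha : a ^ k ∈ N) (hb : b ^ l ∈ N) : (a * b) ^ (k * l) ∈ N := by
  apply mem_of_mk_eq_one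
  have ha' := mk_eq_one_of_mem ha
  have hb' := mk_eq_one_of_mem hb
  rw [QuotientGroup.mk_pow] at ha' hb' ⊢
  rw [QuotientGroup.mk_mul, (mk_commute h).mul_pow, pow_mul, ha', mul_comm k, pow_mul, hb', one_pow, one_pow, one_mul]

theorem mk_commutator_pow_left {N : Subgroup G} [N.Normal] {a b : G} (h : ⁅⁅a, b⁆, a⁆ ∈ N)
    (k : ℕ) : ((⁅a ^ k, b⁆ : G) : G ⧸ N) = ((⁅a, b⁆ ^ k : G) : G ⧸ N) := by
  have h1 := mk_commute h
  rw [mk_commutatorElement] at h1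
  have h2 := commutatorElement_pow_left h1 k
  rw [mk_commutatorElement, QuotientGroup.mk_pow, QuotientGroup.mk_pow, h2, mk_commutatorElement]

/-- Lets exponents pass in and out of commutators, one central layer at a time. -/
theorem commutator_pow_left_mem_iff {N : Subgroup G} [N.Normal] {a b : G}
    (h : ⁅⁅a, b⁆, a⁆ ∈ N) (k : ℕ) : ⁅a ^ k, b⁆ ∈ N ↔ ⁅a, b⁆ ^ k ∈ N := by
  rw [← QuotientGroup.eq_one_iff, mk_commutator_pow_left h, QuotientGroup.eq_one_iff]

theorem commutator_commutator_le_of_rotate {A B C N : Subgroup G} [N.Normal]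
    (h1 : ⁅⁅B, C⁆, A⁆ ≤ N) (h2 : ⁅⁅C, A⁆, B⁆ ≤ N) : ⁅⁅A, B⁆, C⁆ ≤ N := by
  have key : ∀ K : Subgroup G, K.map (QuotientGroup.mk' N) = ⊥ ↔ K ≤ N := fun K => by
    rw [Subgroup.map_eq_bot_iff, QuotientGroup.ker_mk']
  rw [← key, Subgroup.map_commutator, Subgroup.map_commutator] at *
  exact Subgroup.commutator_commutator_eq_bot_of_rotate h1 h2

/-- Induction on j by the three subgroups lemma; the extra 1 comes from indexing from 0. -/
theorem lowerCentralSeries_commutator_le (i j : ℕ) :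
    ⁅(⊤ : Subgroup G).lowerCentralSeries i, (⊤ : Subgroup G).lowerCentralSeries j⁆ ≤
      (⊤ : Subgroup G).lowerCentralSeries (i + j + 1) := by
  induction j generalizing i with
  | zero => exact le_rfl
  | succ j ih =>
    rw [Subgroup.commutator_comm, Subgroup.lowerCentralSeries_succ]
    apply commutator_commutator_le_of_rotate
    · rw [Subgroup.commutator_comm ⊤, ← Subgroup.lowerCentralSeries_succ]
      refine (ih (i + 1)).trans (le_of_eq ?_)
      congr 1; omega
    · exact Subgroup.commutator_mono (ih i) le_rfl

end Commutators

/-! ### Torsion and isolators in nilpotent groups -/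

section Torsion

variable {G : Type*} [Group G]

/-- A nilpotent group generated by torsion elements is a torsion group. -/
theorem isOfFinOrder_of_closure_eq_top [Group.IsNilpotent G] {S : Set G}
    (hS : ∀ s ∈ S, IsOfFinOrder s) (hcl : Subgroup.closure S = ⊤) (g : G) : IsOfFinOrder g := by
  -- Every lower central factor is torsion: the abelianization because its generators are, the later
  -- ones because [p, q]^k is congruent to [p^k, q].
  have step : ∀ i, ∀ g ∈ (⊤ : Subgroup G).lowerCentralSeries i,
      ∃ k, 0 < k ∧ g ^ k ∈ (⊤ : Subgroup G).lowerCentralSeries (i + 1) := by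
    intro i
    induction i with
    | zero =>
      intro g _
      have hg : g ∈ Subgroup.closure S := by rw [hcl]; trivial
      induction hg using Subgroup.closure_induction with
      | mem s hs =>
        obtain ⟨k, hk, hk1⟩ := isOfFinOrder_iff_pow_eq_one.mp (hS s hs)
        exact ⟨k, hk, by rw [hk1]; exact one_mem _⟩
      | one => exact ⟨1, one_pos, by rw [one_pow]; exact one_mem _⟩
      | mul a b _ _ ha hb =>
        obtain ⟨k, hk, ha⟩ := ha trivial
        obtain ⟨l, hl, hb⟩ := hb trivial
        exact ⟨k * l, Nat.mul_pos hk hl, mul_pow_mem_of_commutator_mem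
          (Subgroup.commutator_mem_commutator (Subgroup.mem_top _) (Subgroup.mem_top _)) ha hb⟩
      | inv a _ ha =>
        obtain ⟨k, hk, ha⟩ := ha trivial
        exact ⟨k, hk, by rw [inv_pow]; exact inv_mem ha⟩
    | succ i ih =>
      intro g hg
      rw [Subgroup.mem_lowerCentralSeries_succ_iff] at hg
      induction hg using Subgroup.closure_induction with
      | mem s hs =>
        obtain ⟨p, hp, q, hq, rfl⟩ := hs
        obtain ⟨k, hk, hpk⟩ := ih p hp
        refine ⟨k, hk, ?_⟩
        rw [← commutator_pow_left_mem_iff]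
        · exact Subgroup.commutator_mem_commutator hpk hq
        · exact Subgroup.commutator_mem_commutator
            (Subgroup.commutator_mem_commutator hp hq) (Subgroup.mem_top _)
      | one => exact ⟨1, one_pos, by rw [one_pow]; exact one_mem _⟩
      | mul a b ha' _ ha hb =>
        obtain ⟨k, hk, ha⟩ := ha
        obtain ⟨l, hl, hb⟩ := hb
        exact ⟨k * l, Nat.mul_pos hk hl, mul_pow_mem_of_commutator_mem
          (Subgroup.commutator_mem_commutator
            ((Subgroup.mem_lowerCentralSeries_succ_iff _ _ _).mpr ha') (Subgroup.mem_top _)) ha hb⟩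
      | inv a _ ha =>
        obtain ⟨k, hk, ha⟩ := ha
        exact ⟨k, hk, by rw [inv_pow]; exact inv_mem ha⟩
  have all : ∀ i, ∃ k, 0 < k ∧ g ^ k ∈ (⊤ : Subgroup G).lowerCentralSeries i := by
    intro i
    induction i with
    | zero => exact ⟨1, one_pos, trivial⟩
    | succ i ih =>
      obtain ⟨k, hk, h⟩ := ih
      obtain ⟨l, hl, h⟩ := step i _ h
      exact ⟨k * l, Nat.mul_pos hk hl, by rwa [pow_mul]⟩
  obtain ⟨k, hk, h⟩ := all (Group.nilpotencyClass G)
  rw [Subgroup.lowerCentralSeries_nilpotencyClass, Subgroup.mem_bot] at h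
  exact isOfFinOrder_iff_pow_eq_one.mpr ⟨k, hk, h⟩

theorem isOfFinOrder_mul [Group.IsNilpotent G] {a b : G} (ha : IsOfFinOrder a)
    (hb : IsOfFinOrder b) : IsOfFinOrder (a * b) := by
  have hab : a * b ∈ Subgroup.closure {a, b} :=
    mul_mem (Subgroup.subset_closure (by simp)) (Subgroup.subset_closure (by simp))
  have h1 := isOfFinOrder_of_closure_eq_top (S := ((↑) : Subgroup.closure {a, b} → G) ⁻¹' {a, b})
    (by
      rintro ⟨s, hs⟩ (h | h)
      · rw [← Submonoid.isOfFinOrder_coe]; exact (show s = a from h) ▸ ha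
      · rw [← Submonoid.isOfFinOrder_coe]; exact (show s = b from h) ▸ hb)
    Subgroup.closure_closure_coe_preimage ⟨a * b, hab⟩
  rwa [← Submonoid.isOfFinOrder_coe] at h1

/-- The isolator of a normal subgroup of a nilpotent group. -/
def isolator [Group.IsNilpotent G] (N : Subgroup G) [N.Normal] : Subgroup G where
  carrier := {g | IsOfFinOrder (g : G ⧸ N)}
  mul_mem' ha hb := isOfFinOrder_mul (G := G ⧸ N) ha hb
  one_mem' := IsOfFinOrder.one
  inv_mem' ha := IsOfFinOrder.inv ha

theorem mem_isolator [Group.IsNilpotent G] {N : Subgroup G} [N.Normal] {g : G} :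
    g ∈ isolator N ↔ ∃ k, 0 < k ∧ g ^ k ∈ N := by
  refine isOfFinOrder_iff_pow_eq_one.trans ?_
  simp only [← QuotientGroup.mk_pow, QuotientGroup.eq_one_iff]

theorem mem_isolator_of_pow_mem [Group.IsNilpotent G] {N : Subgroup G} [N.Normal] {g : G} {k : ℕ}
    (hk : 0 < k) (h : g ^ k ∈ isolator N) : g ∈ isolator N := by
  obtain ⟨l, hl, h⟩ := mem_isolator.mp h
  exact mem_isolator.mpr ⟨k * l, Nat.mul_pos hk hl, by rwa [pow_mul]⟩

instance isolator_normal [Group.IsNilpotent G] (N : Subgroup G) [hN : N.Normal] :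
    (isolator N).Normal where
  conj_mem g hg x := by
    obtain ⟨k, hk, h⟩ := mem_isolator.mp hg
    exact mem_isolator.mpr ⟨k, hk, by rw [conj_pow]; exact hN.conj_mem _ h x⟩

/-- Torsion-freeness passes from the center to each upper central factor, since x ↦ [x, y] sends
each factor homomorphically to the one below. -/
theorem mem_upperCentralSeries_of_pow_mem (htf : ∀ g : G, ∀ k, 0 < k → g ^ k = 1 → g = 1)
    {i k : ℕ} (hk : 0 < k) {g : G} (hg : g ∈ Subgroup.upperCentralSeries G (i + 1))
    (hgk : g ^ k ∈ Subgroup.upperCentralSeries G i) : g ∈ Subgroup.upperCentralSeries G i := by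
  induction i generalizing g with
  | zero =>
    rw [Subgroup.upperCentralSeries_zero, Subgroup.mem_bot] at *
    exact htf g k hk hgk
  | succ i ih =>
    intro x
    have h1 := hg x
    exact ih h1 ((commutator_pow_left_mem_iff (N := Subgroup.upperCentralSeries G i) (h1 g) k).mp (hgk x))

theorem pow_mem_upperCentralSeries {m : ℕ} (hm : ∀ g ∈ Subgroup.center G, g ^ m = 1)
    {i : ℕ} {g : G} (hg : g ∈ Subgroup.upperCentralSeries G (i + 1)) :
    g ^ m ∈ Subgroup.upperCentralSeries G i := by
  induction i generalizing g with
  | zero =>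
    rw [zero_add, Subgroup.upperCentralSeries_one] at hg
    rw [hm g hg]
    exact one_mem _
  | succ i ih =>
    intro x
    have h1 := hg x
    exact (commutator_pow_left_mem_iff (N := Subgroup.upperCentralSeries G i) (h1 g) m).mpr (ih h1)

/-- The commutator [g, h] descends the upper central series: in a given layer its k-th power is
congruent to [g^k, h] = 1, and the layers are torsion-free. -/
theorem commute_of_pow_commute [Group.IsNilpotent G]
    (htf : ∀ g : G, ∀ k, 0 < k → g ^ k = 1 → g = 1) {g h : G} {k : ℕ} (hk : 0 < k)
    (hc : Commute (g ^ k) h) : Commute g h := by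
  rw [← commutatorElement_eq_one_iff_commute] at *
  have key : ∀ i, ⁅g, h⁆ ∈ Subgroup.upperCentralSeries G i → ⁅g, h⁆ = 1 := by
    intro i
    induction i with
    | zero => exact id
    | succ i ih =>
      intro hi
      refine ih (mem_upperCentralSeries_of_pow_mem htf hk hi ?_)
      rw [← commutator_pow_left_mem_iff (N := Subgroup.upperCentralSeries G i) (hi g), hc]
      exact one_mem _
  exact key (Group.nilpotencyClass G) (by rw [Subgroup.upperCentralSeries_nilpotencyClass]; trivial)

/-- The filtration by the isolators of the terms of the lower central series. -/
def isolatorFiltration (G : Type*) [Group G] [Group.IsNilpotent G] (i : ℕ) : Subgroup G :=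
  isolator ((⊤ : Subgroup G).lowerCentralSeries (i - 1))

instance isolatorFiltration_normal [Group.IsNilpotent G] (i : ℕ) :
    (isolatorFiltration G i).Normal :=
  isolator_normal _

theorem isolatorFiltration_isFiltration (G : Type*) [Group G] [Group.IsNilpotent G] :
    IsFiltration (isolatorFiltration G) where
  antitone i j hij g hg := by
    obtain ⟨k, hk, h⟩ := mem_isolator.mp hg
    exact mem_isolator.mpr ⟨k, hk, Subgroup.lowerCentralSeries_antitone _ (by omega) h⟩
  one := eq_top_iff.mpr fun g _ => mem_isolator.mpr ⟨1, one_pos, trivial⟩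
  normal i := inferInstance
  comm i j g hg h hh := by
    rcases Nat.eq_zero_or_pos i with rfl | hi
    · rw [zero_add]
      exact mul_mem (Subgroup.Normal.conj_mem inferInstance h hh g) (inv_mem hh)
    rcases Nat.eq_zero_or_pos j with rfl | hj
    · rw [add_zero, mul_assoc, mul_assoc, ← mul_assoc h]
      exact mul_mem hg (Subgroup.Normal.conj_mem inferInstance _ (inv_mem hg) h)
    obtain ⟨k, hk, hgk⟩ := mem_isolator.mp hg
    obtain ⟨l, hl, hhl⟩ := mem_isolator.mp hh
    -- Suitable powers of g and h lie in true lower central terms, so they commute modulo the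
    -- isolator; as this quotient is torsion-free, g and h commute there too.
    have htf : ∀ x : G ⧸ isolatorFiltration G (i + j), ∀ k, 0 < k → x ^ k = 1 → x = 1 := by
      intro x k hk hx
      induction x using QuotientGroup.induction_on with
      | H x =>
        rw [← QuotientGroup.mk_pow, QuotientGroup.eq_one_iff] at hx
        rw [QuotientGroup.eq_one_iff]
        exact mem_isolator_of_pow_mem hk hx
    have h1 : ⁅g ^ k, h ^ l⁆ ∈ isolatorFiltration G (i + j) := by
      refine mem_isolator.mpr ⟨1, one_pos, ?_⟩
      have := lowerCentralSeries_commutator_le (i - 1) (j - 1)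
        (Subgroup.commutator_mem_commutator hgk hhl)
      rw [pow_one]
      rwa [show i + j - 1 = i - 1 + (j - 1) + 1 by omega]
    have h2 := mk_commute h1
    rw [QuotientGroup.mk_pow, QuotientGroup.mk_pow] at h2
    have h3 := (commute_of_pow_commute htf hl (commute_of_pow_commute htf hk h2).symm).symm
    rw [← commutatorElement_eq_one_iff_commute, ← mk_commutatorElement] at h3
    exact mem_of_mk_eq_one h3

theorem isOfFinOrder_of_mem_isolatorFiltration [Group.IsNilpotent G] {g : G}
    (hg : g ∈ isolatorFiltration G (Group.nilpotencyClass G + 1)) : IsOfFinOrder g := by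
  obtain ⟨k, hk, h⟩ := mem_isolator.mp hg
  rw [Nat.add_sub_cancel, Subgroup.lowerCentralSeries_nilpotencyClass, Subgroup.mem_bot] at h
  exact isOfFinOrder_iff_pow_eq_one.mpr ⟨k, hk, h⟩

end Torsion

/-! ### Subgroups of finitely generated nilpotent groups are finitely generated -/

section Noetherian

theorem CommGroup.subgroup_fg {A : Type*} [CommGroup A] [Group.FG A] (H : Subgroup A) : H.FG := by
  rw [Subgroup.fg_iff_add_fg]
  have : Module.Finite ℤ (Additive A) := Module.Finite.iff_addGroup_fg.mpr inferInstance
  have h1 := IsNoetherian.noetherian (R := ℤ) (AddSubgroup.toIntSubmodule H.toAddSubgroup)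
  rw [Submodule.fg_iff_addSubgroup_fg] at h1
  simpa using h1

theorem fg_of_le_of_isMulCommutative {G : Type*} [Group G] {H N : Subgroup G} (hHN : H ≤ N)
    (hN : N.FG) (hcomm : ∀ x ∈ N, ∀ y ∈ N, x * y = y * x) : H.FG := by
  have : Group.FG N := (Group.fg_iff_subgroup_fg N).mpr hN
  let _ : CommGroup N := { (inferInstance : Group N) with
    mul_comm := fun x y => Subtype.ext (hcomm x x.2 y y.2) }
  have h1 : (H.subgroupOf N).FG := CommGroup.subgroup_fg _
  rw [← Group.fg_iff_subgroup_fg] at h1 ⊢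
  exact Group.fg_of_surjective (f := (Subgroup.subgroupOfEquivOfLe hHN).toMonoidHom)
    (Subgroup.subgroupOfEquivOfLe hHN).surjective

theorem exists_finite_lift {G : Type*} [Group G] (N : Subgroup G) [N.Normal] (H : Subgroup G)
    (h : (H.map (QuotientGroup.mk' N)).FG) :
    ∃ U : Set G, U.Finite ∧ U ⊆ H ∧ H ≤ Subgroup.closure U ⊔ N := by
  obtain ⟨S, hS, hSfin⟩ := (Subgroup.fg_iff _).mp h
  have hmem : ∀ s ∈ S, ∃ x ∈ H, QuotientGroup.mk' N x = s := fun s hs => by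
    have : s ∈ H.map (QuotientGroup.mk' N) := hS ▸ Subgroup.subset_closure hs
    exact this
  choose! r hr hrs using hmem
  refine ⟨r '' S, hSfin.image r, by rintro _ ⟨s, hs, rfl⟩; exact hr s hs, fun x hx => ?_⟩
  have h1 : QuotientGroup.mk' N x ∈ (Subgroup.closure (r '' S)).map (QuotientGroup.mk' N) := by
    rw [MonoidHom.map_closure, Set.image_image, Set.image_congr hrs, Set.image_id', hS]
    exact Subgroup.mem_map_of_mem _ hx
  rw [← Subgroup.mem_comap, Subgroup.comap_map_eq, QuotientGroup.ker_mk'] at h1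
  exact h1

theorem fg_of_map_of_inf {G : Type*} [Group G] (N : Subgroup G) [N.Normal] (H : Subgroup G)
    (h : (H.map (QuotientGroup.mk' N)).FG) (h' : (H ⊓ N).FG) : H.FG := by
  obtain ⟨U, hU, hUH, hle⟩ := exists_finite_lift N H h
  have hcl : Subgroup.closure U ≤ H := (Subgroup.closure_le H).mpr hUH
  have h1 : H = Subgroup.closure U ⊔ (H ⊓ N) := by
    refine le_antisymm (fun x hx => ?_) (sup_le hcl inf_le_left)
    obtain ⟨y, hy, z, hz, rfl⟩ := Subgroup.mem_sup_of_normal_right.mp (hle hx)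
    exact mul_mem (Subgroup.mem_sup_left hy) (Subgroup.mem_sup_right
      ⟨(Subgroup.mul_mem_cancel_left H (hcl hy)).mp hx, hz⟩)
  rw [h1]
  exact Subgroup.FG.sup ((Subgroup.fg_iff _).mpr ⟨U, rfl, hU⟩) h'

theorem commutator_mem_of_closure {G : Type*} [Group G] {X : Set G}
    (hX : Subgroup.closure X = ⊤) {L : Subgroup G} [L.Normal] {g : G}
    (h : ∀ x ∈ X, ⁅g, x⁆ ∈ L) (y : G) : ⁅g, y⁆ ∈ L := by
  have h1 : Subgroup.closure X ≤
      (Subgroup.centralizer {(g : G ⧸ L)}).comap (QuotientGroup.mk' L) := by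
    rw [Subgroup.closure_le]
    intro x hx
    refine Subgroup.mem_comap.mpr (Subgroup.mem_centralizer_singleton_iff.mpr ?_)
    exact (mk_commute (h x hx)).symm
  rw [hX] at h1
  have h2 := Subgroup.mem_centralizer_singleton_iff.mp
    (Subgroup.mem_comap.mp (h1 (Subgroup.mem_top y)))
  apply mem_of_mk_eq_one
  rw [mk_commutatorElement, commutatorElement_eq_one_iff_mul_comm]
  exact h2.symm

/-- Induction on the length: modulo the central last term N the induction hypothesis applies. N
itself is generated by the commutators of generators of G with lifts of generators of the preceding
term, as changing a lift by a central element does not alter the commutator. -/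
theorem fg_of_lowerCentralSeries_eq_bot (n : ℕ) (G : Type u) [Group G] [Group.FG G]
    (hn : (⊤ : Subgroup G).lowerCentralSeries n = ⊥) (H : Subgroup G) : H.FG := by
  induction n generalizing G with
  | zero =>
    have : H = ⊥ := le_bot_iff.mp (le_top.trans hn.le)
    rw [this]
    exact Subgroup.FG.bot
  | succ n ih =>
    set N := (⊤ : Subgroup G).lowerCentralSeries n with hN
    have hNc : ∀ z ∈ N, ∀ x : G, ⁅z, x⁆ = 1 := fun z hz x => by
      have : ⁅z, x⁆ ∈ (⊤ : Subgroup G).lowerCentralSeries (n + 1) :=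
        Subgroup.commutator_mem_commutator hz (Subgroup.mem_top x)
      rwa [hn, Subgroup.mem_bot] at this
    have hQ : ∀ K : Subgroup (G ⧸ N), K.FG := by
      refine ih (G ⧸ N) ?_
      rw [← Subgroup.map_top_of_surjective _ (QuotientGroup.mk'_surjective N),
        ← Subgroup.map_lowerCentralSeries, Subgroup.map_eq_bot_iff, QuotientGroup.ker_mk']
    have hNfg : N.FG := by
      rcases n with _ | n
      · exact Group.fg_def.mp inferInstance
      · obtain ⟨X, hX, hXfin⟩ := Group.fg_iff.mp (inferInstance : Group.FG G)
        obtain ⟨U, hU, hUH, hle⟩ := exists_finite_lift N _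
          (hQ (((⊤ : Subgroup G).lowerCentralSeries n).map (QuotientGroup.mk' N)))
        set V := Set.image2 (fun u x => ⁅u, x⁆) U X with hV
        have hVN : Subgroup.closure V ≤ N := by
          rw [Subgroup.closure_le]
          rintro _ ⟨u, hu, x, -, rfl⟩
          exact Subgroup.commutator_mem_commutator (hUH hu) (Subgroup.mem_top x)
        have : (Subgroup.closure V).Normal := ⟨fun z hz x => by
          have := commutatorElement_eq_one_iff_mul_comm.mp (hNc z (hVN hz) x)
          rwa [← this, mul_inv_cancel_right]⟩
        refine (Subgroup.fg_iff _).mpr ⟨V, le_antisymm hVN ?_, hU.image2 _ hXfin⟩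
        refine Subgroup.commutator_le.mpr fun p hp q _ => ?_
        have h1 : Subgroup.closure U ⊔ N ≤ Subgroup.upperCentralSeriesStep (Subgroup.closure V) := by
          refine sup_le ((Subgroup.closure_le _).mpr fun u hu => ?_) fun z hz x => ?_
          · exact commutator_mem_of_closure hX fun x hx =>
              Subgroup.subset_closure ⟨u, hu, x, hx, rfl⟩
          · rw [hNc z hz x]
            exact one_mem _
        exact h1 (hle hp) q
    refine fg_of_map_of_inf N H (hQ _) (fg_of_le_of_isMulCommutative inf_le_right hNfg ?_)
    exact fun x hx y _ => commutatorElement_eq_one_iff_mul_comm.mp (hNc x hx y)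

theorem subgroup_fg (G : Type u) [Group G] [Group.FG G] [Group.IsNilpotent G] (H : Subgroup G) :
    H.FG :=
  fg_of_lowerCentralSeries_eq_bot _ G Subgroup.lowerCentralSeries_nilpotencyClass H

end Noetherian

/-! ### Existence of a cyclic refinement of the upper central series -/

section Series

/-- The subgroup `A` is the top term of a series with cyclic factors that contains the first `k`
terms of the upper central series. -/
def HasCyclicSeries {G : Type u} [Group G] (k : ℕ) (A : Subgroup G) : Prop :=
  ∃ (n : ℕ) (S : ℕ → Subgroup G), S 0 = A ∧ S n = ⊥ ∧ Antitone S ∧ (∀ i, (S i).Normal) ∧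
    (∀ i, ∃ g ∈ S i, ∀ x ∈ S i, ∃ a : ℤ, (g ^ a)⁻¹ * x ∈ S (i + 1)) ∧
    ∀ j ≤ k, ∃ i ≤ n, S i = Subgroup.upperCentralSeries G j

theorem HasCyclicSeries.cons {G : Type u} [Group G] {k : ℕ} {A A' : Subgroup G}
    (h : HasCyclicSeries k A) (hA : A ≤ A') (hA' : A'.Normal) {g : G} (hg : g ∈ A')
    (hgen : ∀ x ∈ A', ∃ a : ℤ, (g ^ a)⁻¹ * x ∈ A) : HasCyclicSeries k A' := by
  obtain ⟨n, S, h0, hn, hanti, hnor, hcyc, hZ⟩ := h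
  refine ⟨n + 1, fun i => Nat.casesOn i A' S, rfl, hn, ?_, ?_, ?_, ?_⟩
  · refine antitone_nat_of_succ_le fun i => ?_
    cases i with
    | zero => exact h0.le.trans hA
    | succ i => exact hanti (Nat.le_succ i)
  · intro i
    cases i with
    | zero => exact hA'
    | succ i => exact hnor i
  · intro i
    cases i with
    | zero => exact ⟨g, hg, by simpa [h0] using hgen⟩
    | succ i => exact hcyc i
  · intro j hj
    obtain ⟨i, hi, h⟩ := hZ j hj
    exact ⟨i + 1, by omega, h⟩

/-- Generators of the (k+1)-st term are adjoined to the k-th one by one; every intermediate subgroup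
is normal because the factor is central. -/
theorem hasCyclicSeries_upperCentralSeries {G : Type u} [Group G] [Group.FG G]
    [Group.IsNilpotent G] (k : ℕ) : HasCyclicSeries k (Subgroup.upperCentralSeries G k) := by
  induction k with
  | zero =>
    refine ⟨0, fun _ => ⊥, rfl, rfl, antitone_const, fun _ => inferInstance, fun _ =>
      ⟨1, one_mem _, fun x hx => ⟨0, by simpa using hx⟩⟩, fun j hj => ⟨0, le_rfl, ?_⟩⟩
    rw [Nat.le_zero.mp hj, Subgroup.upperCentralSeries_zero]
  | succ k ih =>
    set Z := Subgroup.upperCentralSeries G with hZ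
    obtain ⟨U, hU⟩ := subgroup_fg G (Z (k + 1))
    have key : ∀ F : Finset G, (F : Set G) ⊆ Z (k + 1) → ∃ A : Subgroup G, A.Normal ∧ Z k ≤ A ∧
        A ≤ Z (k + 1) ∧ (F : Set G) ⊆ A ∧ HasCyclicSeries k A := by
      classical
      intro F
      induction F using Finset.induction_on with
      | empty =>
        exact fun _ => ⟨Z k, inferInstance, le_rfl,
          Subgroup.upperCentralSeries_mono G (Nat.le_succ k), by simp, ih⟩
      | insert y F _ ihF =>
        intro hF
        rw [Finset.coe_insert, Set.insert_subset_iff] at hF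
        obtain ⟨A, hA, hZA, hAZ, hFA, hcyc⟩ := ihF hF.2
        have hle : Subgroup.zpowers y ⊔ A ≤ Z (k + 1) :=
          sup_le ((Subgroup.zpowers_le).mpr hF.1) hAZ
        have hnor : (Subgroup.zpowers y ⊔ A).Normal := ⟨fun z hz x => by
          have h1 : ⁅z, x⁆ ∈ Z k := hle hz x
          have h2 : x * z * x⁻¹ = ⁅z, x⁆⁻¹ * z := by rw [commutatorElement_def]; group
          rw [h2]
          exact mul_mem (inv_mem (Subgroup.mem_sup_right (hZA h1))) hz⟩
        have hy : y ∈ Subgroup.zpowers y ⊔ A := Subgroup.mem_sup_left (Subgroup.mem_zpowers y)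
        refine ⟨_, hnor, hZA.trans le_sup_right, hle, ?_, hcyc.cons le_sup_right hnor hy ?_⟩
        · rw [Finset.coe_insert, Set.insert_subset_iff]
          exact ⟨hy, hFA.trans (SetLike.coe_subset_coe.mpr le_sup_right)⟩
        · intro x hx
          obtain ⟨_, ⟨a, rfl⟩, z, hz, rfl⟩ := Subgroup.mem_sup_of_normal_right.mp hx
          exact ⟨a, by simpa using hz⟩
    obtain ⟨A, hA, hZA, hAZ, hUA, n, S, h0, hn, hanti, hnor, hcyc, hS⟩ :=
      key U (by rw [← hU]; exact Subgroup.subset_closure)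
    have hAeq : A = Z (k + 1) := le_antisymm hAZ (by rw [← hU]; exact (Subgroup.closure_le A).mpr hUA)
    refine ⟨n, S, h0.trans hAeq, hn, hanti, hnor, hcyc, fun j hj => ?_⟩
    rcases Nat.lt_or_ge k j with hkj | hkj
    · obtain rfl : j = k + 1 := by omega
      exact ⟨0, Nat.zero_le n, h0.trans hAeq⟩
    · exact hS j hkj

theorem exists_isCyclicCentralRefinement (G : Type u) [Group G] [Group.FG G]
    [Group.IsNilpotent G] :
    ∃ (n : ℕ) (S : Fin (n + 1) → Subgroup G), IsCyclicCentralRefinement G n S := by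
  obtain ⟨n, S, h0, hn, hanti, hnor, hcyc, hZ⟩ :=
    hasCyclicSeries_upperCentralSeries (G := G) (Group.nilpotencyClass G)
  rw [Subgroup.upperCentralSeries_nilpotencyClass] at h0
  refine ⟨n, fun i => S i, fun i j hij => hanti hij, h0, hn, fun k => ?_, fun i => hnor i,
    fun i => ?_⟩
  · obtain ⟨i, hi, h⟩ := hZ (min k (Group.nilpotencyClass G)) (min_le_right _ _)
    refine ⟨⟨i, by omega⟩, h.trans ?_⟩
    rcases le_total k (Group.nilpotencyClass G) with hk | hk
    · rw [min_eq_left hk]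
    · rw [min_eq_right hk, Subgroup.upperCentralSeries_nilpotencyClass,
        Subgroup.upperCentralSeries_eq_top_iff_nilpotencyClass_le.mpr hk]
  · obtain ⟨g, hg, hgen⟩ := hcyc i
    have := hnor (i + 1)
    refine ⟨⟨QuotientGroup.mk ⟨g, hg⟩, fun x => ?_⟩⟩
    induction x using QuotientGroup.induction_on with
    | H x =>
      obtain ⟨a, ha⟩ := hgen x x.2
      refine ⟨a, ?_⟩
      refine QuotientGroup.eq.mpr ?_
      simpa [Subgroup.mem_subgroupOf] using ha

end Series

/-! ### Index of the subgroup of m-th powers; torsion-free normal subgroups -/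

section IndexBound

/-- A central series refining the upper central series, with generators `g i` of its factors;
`I` is the set of indices of the infinite factors. -/
structure CyclicData {G : Type u} [Group G] (n : ℕ) (T : ℕ → Subgroup G) (g : ℕ → G)
    (I : Finset ℕ) (e : ℕ → ℕ) : Prop where
  subset : I ⊆ Finset.range n
  zero : T 0 = ⊤
  last : T n = ⊥
  antitone : Antitone T
  normal : ∀ i, (T i).Normal
  refines : ∀ k, ∃ i, T i = Subgroup.upperCentralSeries G k
  mem : ∀ i, g i ∈ T i
  gen : ∀ i, ∀ x ∈ T i, ∃ a : ℤ, (g i ^ a)⁻¹ * x ∈ T (i + 1)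
  infinite : ∀ i ∈ I, ∀ a : ℤ, g i ^ a ∈ T (i + 1) → a = 0
  finite : ∀ i, i ∉ I → 0 < e i ∧ g i ^ e i ∈ T (i + 1)

theorem relIndex_le_of_cyclic {G : Type*} [Group G] {A B : Subgroup G} {g : G} (hg : g ∈ B)
    (hgen : ∀ x ∈ B, ∃ a : ℤ, (g ^ a)⁻¹ * x ∈ A) {m : ℕ} (hm : 0 < m) (hgm : g ^ m ∈ A) :
    Finite (B ⧸ A.subgroupOf B) ∧ A.relIndex B ≤ m := by
  have hsurj : Function.Surjective
      (fun r : Fin m => ((⟨g ^ (r : ℕ), pow_mem hg _⟩ : B) : B ⧸ A.subgroupOf B)) := by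
    intro x
    induction x using QuotientGroup.induction_on with
    | H x =>
      obtain ⟨a, ha⟩ := hgen x x.2
      have hm' : (m : ℤ) ≠ 0 := by exact_mod_cast hm.ne'
      have h0 := Int.emod_nonneg a hm'
      have hlt := Int.emod_lt_of_pos a (Int.natCast_pos.mpr hm)
      refine ⟨⟨(a % m).toNat, by omega⟩, QuotientGroup.eq.mpr ?_⟩
      rw [Subgroup.mem_subgroupOf]
      have h1 : g ^ (a % m).toNat = g ^ (a % (m : ℤ)) := by
        rw [← zpow_natCast, Int.toNat_of_nonneg h0]
      have h2 : g ^ (a % (m : ℤ)) = g ^ a * (g ^ m) ^ (-(a / (m : ℤ))) := by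
        rw [← zpow_natCast, ← zpow_mul, ← zpow_add, Int.emod_def]
        congr 1
        ring
      have h3 : (g ^ (a % m).toNat)⁻¹ * (x : G) =
          (g ^ m) ^ (a / (m : ℤ)) * ((g ^ a)⁻¹ * x) := by
        rw [h1, h2]
        simp [mul_assoc]
      simpa [h3] using mul_mem (zpow_mem hgm (a / (m : ℤ))) ha
  refine ⟨Finite.of_surjective _ hsurj, ?_⟩
  have := Nat.card_le_card_of_surjective _ hsurj
  rwa [Nat.card_fin] at this

theorem IsCyclicCentralRefinement.exists_cyclicData {G : Type u} [Group G] {n : ℕ}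
    {S : Fin (n + 1) → Subgroup G} (hS : IsCyclicCentralRefinement G n S) :
    ∃ T g I e, CyclicData (G := G) n T g I e ∧ I.card = numInfiniteFactors S := by
  classical
  have hgen : ∀ i : Fin n, ∃ g ∈ S i.castSucc, ∀ x ∈ S i.castSucc, ∃ a : ℤ,
      (g ^ a)⁻¹ * x ∈ S i.succ := by
    intro i
    have := hS.normal i.succ
    obtain ⟨y, hy⟩ := (hS.cyclic i).exists_generator
    obtain ⟨g, rfl⟩ := QuotientGroup.mk_surjective y
    refine ⟨g, g.2, fun x hx => ?_⟩
    obtain ⟨a, ha⟩ := hy (QuotientGroup.mk ⟨x, hx⟩)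
    refine ⟨a, ?_⟩
    simpa [Subgroup.mem_subgroupOf] using QuotientGroup.eq.mp ha
  choose g hg hgen using hgen
  -- Padding by trivial data beyond n avoids `Fin` arithmetic later.
  set T : ℕ → Subgroup G := fun i => if h : i < n + 1 then S ⟨i, h⟩ else ⊥ with hT
  have hTS : ∀ i : Fin (n + 1), T i = S i := fun i => by
    simp only [hT, dif_pos i.is_lt]
  have hTs : ∀ i : Fin n, T (i + 1) = S i.succ := fun i => by rw [← hTS]; simp
  have hTc : ∀ i : Fin n, T i = S i.castSucc := fun i => by rw [← hTS]; simp
  have hTbot : ∀ i, n ≤ i → T i = ⊥ := fun i hi => by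
    rcases hi.eq_or_lt with rfl | hi
    · rw [← hS.last, ← hTS, Fin.val_last]
    · simp only [hT]
      rw [dif_neg (by omega)]
  set g' : ℕ → G := fun i => if h : i < n then g ⟨i, h⟩ else 1 with hg'
  have hg'' : ∀ i : Fin n, g' i = g i := fun i => by simp [hg']
  set J : Finset (Fin n) := Finset.univ.filter fun i =>
    Infinite (S i.castSucc ⧸ (S i.succ).subgroupOf (S i.castSucc)) with hJ
  have hfin : ∀ i : Fin n, Finite (S i.castSucc ⧸ (S i.succ).subgroupOf (S i.castSucc)) →
      ∃ e, 0 < e ∧ g i ^ e ∈ S i.succ := fun i hi => by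
    have := hS.normal i.succ
    refine ⟨Nat.card (S i.castSucc ⧸ (S i.succ).subgroupOf (S i.castSucc)), Nat.card_pos, ?_⟩
    have h1 := pow_card_eq_one' (G := S i.castSucc ⧸ (S i.succ).subgroupOf (S i.castSucc))
      (x := QuotientGroup.mk ⟨g i, hg i⟩)
    rw [← QuotientGroup.mk_pow, QuotientGroup.eq_one_iff, Subgroup.mem_subgroupOf] at h1
    simpa using h1
  have hfin' : ∀ i : Fin n, ∃ e, Finite (S i.castSucc ⧸ (S i.succ).subgroupOf (S i.castSucc)) →
      0 < e ∧ g i ^ e ∈ S i.succ := fun i => by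
    by_cases h : Finite (S i.castSucc ⧸ (S i.succ).subgroupOf (S i.castSucc))
    · obtain ⟨e, he⟩ := hfin i h
      exact ⟨e, fun _ => he⟩
    · exact ⟨0, fun h' => absurd h' h⟩
  choose e he using hfin'
  refine ⟨T, g', J.map Fin.valEmbedding, fun i => if h : i < n then e ⟨i, h⟩ else 1,
    ⟨?_, ?_, hTbot n le_rfl, ?_, ?_, ?_, ?_, ?_, ?_, ?_⟩, ?_⟩
  · intro i hi
    obtain ⟨j, -, rfl⟩ := Finset.mem_map.mp hi
    simp
  · rw [← hS.first]; exact hTS 0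
  · intro i j hij
    by_cases hj : j < n + 1
    · have hi : i < n + 1 := by omega
      simp only [hT, dif_pos hi, dif_pos hj]
      exact hS.antitone hij
    · rw [hTbot j (by omega)]
      exact bot_le
  · intro i
    by_cases hi : i < n + 1
    · simp only [hT, dif_pos hi]
      exact hS.normal _
    · rw [hTbot i (by omega)]
      infer_instance
  · intro k
    obtain ⟨i, hi⟩ := hS.refines k
    exact ⟨i, (hTS i).trans hi⟩
  · intro i
    by_cases hi : i < n
    · have := hg ⟨i, hi⟩
      rwa [← hTc, ← hg''] at this
    · simp only [hg', dif_neg hi]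
      exact one_mem _
  · intro i x hx
    by_cases hi : i < n
    · have := hgen ⟨i, hi⟩ x
      rw [← hTc, ← hTs, ← hg''] at this
      exact this hx
    · rw [hTbot i (by omega), Subgroup.mem_bot] at hx
      exact ⟨0, by simp [hx, one_mem]⟩
  · intro i hi a ha
    obtain ⟨i, hiJ, rfl⟩ := Finset.mem_map.mp hi
    rw [hJ, Finset.mem_filter] at hiJ
    by_contra ha0
    refine hiJ.2.not_finite (relIndex_le_of_cyclic (hg i) (hgen i)
      (Int.natAbs_pos.mpr ha0) ?_).1
    rw [Fin.valEmbedding_apply, hTs, hg''] at ha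
    rcases Int.natAbs_eq a with h | h
    · rwa [h, zpow_natCast] at ha
    · rwa [h, zpow_neg, zpow_natCast, inv_mem_iff] at ha
  · intro i hi
    by_cases hin : i < n
    · simp only [dif_pos hin]
      have h1 := he ⟨i, hin⟩ (by
        by_contra h
        exact hi (Finset.mem_map.mpr ⟨⟨i, hin⟩, by
          rw [hJ, Finset.mem_filter]; exact ⟨Finset.mem_univ _, not_finite_iff_infinite.mp h⟩,
          rfl⟩))
      rw [← hTs, ← hg''] at h1
      exact h1
    · simp only [dif_neg hin, hg', one_pow]
      exact ⟨one_pos, one_mem _⟩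
  · rw [Finset.card_map, numInfiniteFactors, Nat.card_eq_fintype_card, Fintype.card_subtype]

/-- The subgroup generated by the `m`-th powers. -/
def powSubgroup (G : Type*) [Group G] (m : ℕ) : Subgroup G :=
  Subgroup.closure (Set.range fun g : G => g ^ m)

theorem pow_mem_powSubgroup {G : Type*} [Group G] (m : ℕ) (g : G) : g ^ m ∈ powSubgroup G m :=
  Subgroup.subset_closure ⟨g, rfl⟩

instance powSubgroup_normal (G : Type*) [Group G] (m : ℕ) : (powSubgroup G m).Normal where
  conj_mem x hx y := by
    have h1 : powSubgroup G m ≤ (powSubgroup G m).comap (MulAut.conj y).toMonoidHom := by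
      refine (Subgroup.closure_le _).mpr ?_
      rintro _ ⟨g, rfl⟩
      refine Subgroup.mem_comap.mpr ?_
      rw [map_pow]
      exact pow_mem_powSubgroup m _
    exact h1 hx

/-- With L generated by the m-th powers, passing from L ⊔ T j to L ⊔ T (j + 1) multiplies the index
by at most m at an infinite factor and by at most e j, independent of m, at a finite one. -/
theorem CyclicData.index_powSubgroup {G : Type u} [Group G] {n : ℕ} {T : ℕ → Subgroup G}
    {g : ℕ → G} {I : Finset ℕ} {e : ℕ → ℕ} (h : CyclicData n T g I e) :
    ∃ C : ℕ, ∀ m, 0 < m → (powSubgroup G m).index ≠ 0 ∧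
      (powSubgroup G m).index ≤ C * m ^ I.card := by
  classical
  refine ⟨∏ i ∈ Finset.range n \ I, e i, fun m hm => ?_⟩
  set L := powSubgroup G m
  have key : ∀ j, (L ⊔ T j).index ≠ 0 ∧
      (L ⊔ T j).index ≤ ∏ i ∈ Finset.range j, if i ∈ I then m else e i := by
    intro j
    induction j with
    | zero => simp [h.zero]
    | succ j ih =>
      have hle : L ⊔ T (j + 1) ≤ L ⊔ T j := sup_le_sup_left (h.antitone (Nat.le_succ j)) L
      have hgen : ∀ x ∈ L ⊔ T j, ∃ a : ℤ, (g j ^ a)⁻¹ * x ∈ L ⊔ T (j + 1) := by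
        intro x hx
        obtain ⟨l, hl, s, hs, rfl⟩ := Subgroup.mem_sup_of_normal_left.mp hx
        obtain ⟨a, ha⟩ := h.gen j s hs
        refine ⟨a, ?_⟩
        have h1 : (g j ^ a)⁻¹ * (l * s) = (g j ^ a)⁻¹ * l * (g j ^ a)⁻¹⁻¹ * ((g j ^ a)⁻¹ * s) := by
          group
        rw [h1]
        exact mul_mem (Subgroup.mem_sup_left
          (Subgroup.Normal.conj_mem inferInstance l hl _)) (Subgroup.mem_sup_right ha)
      have hpow : 0 < (if j ∈ I then m else e j) ∧
          g j ^ (if j ∈ I then m else e j) ∈ L ⊔ T (j + 1) := by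
        split_ifs with hj
        · exact ⟨hm, Subgroup.mem_sup_left (pow_mem_powSubgroup m _)⟩
        · exact ⟨(h.finite j hj).1, Subgroup.mem_sup_right (h.finite j hj).2⟩
      obtain ⟨h1, h2⟩ := relIndex_le_of_cyclic (Subgroup.mem_sup_right (h.mem j)) hgen
        hpow.1 hpow.2
      rw [← Subgroup.relIndex_mul_index hle, Finset.prod_range_succ, mul_comm]
      exact ⟨mul_ne_zero ih.1 Subgroup.index_ne_zero_of_finite, Nat.mul_le_mul ih.2 h2⟩
  have h1 := key n
  rw [h.last, sup_bot_eq] at h1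
  refine ⟨h1.1, h1.2.trans_eq ?_⟩
  rw [← Finset.prod_sdiff h.subset, Finset.prod_congr rfl fun i hi =>
    if_neg (Finset.mem_sdiff.mp hi).2, Finset.prod_congr (s₁ := I) rfl fun i hi => if_pos hi,
    Finset.prod_const]

theorem index_powSubgroup_ne_zero (G : Type u) [Group G] [Group.FG G] [Group.IsNilpotent G]
    {m : ℕ} (hm : 0 < m) : (powSubgroup G m).index ≠ 0 := by
  obtain ⟨n, S, hS⟩ := exists_isCyclicCentralRefinement G
  obtain ⟨T, g, I, e, h, -⟩ := hS.exists_cyclicData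
  obtain ⟨C, hC⟩ := h.index_powSubgroup
  exact (hC m hm).1

/-- An exponent of the center kills every upper central factor, so G has finite exponent; the then
trivial subgroup of powers has finite index. -/
theorem finite_of_center_pow_eq_one (G : Type u) [Group G] [Group.FG G] [Group.IsNilpotent G]
    {m : ℕ} (hm : 0 < m) (h : ∀ g ∈ Subgroup.center G, g ^ m = 1) : Finite G := by
  have key : ∀ k, ∀ g ∈ Subgroup.upperCentralSeries G k, g ^ m ^ k = 1 := by
    intro k
    induction k with
    | zero => intro g hg; simpa using hg
    | succ k ih =>
      intro g hg
      rw [pow_succ', pow_mul]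
      exact ih _ (pow_mem_upperCentralSeries h hg)
  have h1 := index_powSubgroup_ne_zero G (pow_pos hm (Group.nilpotencyClass G))
  have h2 : powSubgroup G (m ^ Group.nilpotencyClass G) = ⊥ := by
    refine (Subgroup.closure_eq_bot_iff).mpr ?_
    rintro _ ⟨g, rfl⟩
    exact key _ g (by rw [Subgroup.upperCentralSeries_nilpotencyClass]; trivial)
  rw [h2, Subgroup.index_bot] at h1
  exact Nat.finite_of_card_ne_zero h1

/-- A finitely generated nilpotent group has a torsion-free normal subgroup of finite index. -/
theorem exists_torsionFree_normal (G : Type u) [Group G] [Group.FG G] [Group.IsNilpotent G] :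
    ∃ K : Subgroup G, K.Normal ∧ K.index ≠ 0 ∧ ∀ x ∈ K, IsOfFinOrder x → x = 1 := by
  obtain ⟨K, -, hK⟩ := zorn_le_nonempty₀
    {K : Subgroup G | K.Normal ∧ ∀ x ∈ K, IsOfFinOrder x → x = 1} (fun c hc hchain y hy => by
      have hne : c.Nonempty := ⟨y, hy⟩
      refine ⟨sSup c, ⟨⟨fun x hx z => ?_⟩, fun x hx => ?_⟩, fun z hz => le_sSup hz⟩
      · rw [Subgroup.mem_sSup_of_directedOn hne hchain.directedOn] at hx ⊢
        obtain ⟨s, hs, hx⟩ := hx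
        exact ⟨s, hs, (hc hs).1.conj_mem x hx z⟩
      · rw [Subgroup.mem_sSup_of_directedOn hne hchain.directedOn] at hx
        obtain ⟨s, hs, hx⟩ := hx
        exact (hc hs).2 x hx) ⊥ ⟨inferInstance, fun x hx _ => hx⟩
  have hKn : K.Normal := hK.prop.1
  refine ⟨K, hKn, ?_, hK.prop.2⟩
  -- Maximality of K: a normal subgroup of G/K without nontrivial images of torsion elements is
  -- trivial.
  have hmax : ∀ A : Subgroup (G ⧸ K), A.Normal →
      (∀ x : G, IsOfFinOrder x → (x : G ⧸ K) ∈ A → (x : G ⧸ K) = 1) → A = ⊥ := by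
    intro A hA hAx
    have h1 : A.comap (QuotientGroup.mk' K) ≤ K := hK.le_of_ge ⟨hA.comap _, fun x hx hfin =>
      hK.prop.2 x (mem_of_mk_eq_one (hAx x hfin hx)) hfin⟩ (fun x hx => by
        rw [Subgroup.mem_comap, QuotientGroup.mk'_apply, mk_eq_one_of_mem hx]
        exact one_mem A)
    refine eq_bot_iff.mpr fun x hx => ?_
    induction x using QuotientGroup.induction_on with
    | H x => exact mk_eq_one_of_mem (h1 hx)
  set Z := Subgroup.center (G ⧸ K)
  let _ : CommGroup Z := { (inferInstance : Group Z) with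
    mul_comm := fun x y => Subtype.ext (Subgroup.mem_center_iff.mp y.2 x) }
  have hZfg : Group.FG Z := (Group.fg_iff_subgroup_fg Z).mpr (subgroup_fg _ Z)
  have hTfg : Group.FG (CommGroup.torsion Z) :=
    (Group.fg_iff_subgroup_fg _).mpr (CommGroup.subgroup_fg _)
  have hTfin : Finite (CommGroup.torsion Z) :=
    CommGroup.finite_of_fg_isMulTorsion _ fun x =>
      Submonoid.isOfFinOrder_coe.mp x.2
  set m := Nat.card (CommGroup.torsion Z)
  have hm : 0 < m := Nat.card_pos
  have hZm : ∀ z : Z, IsOfFinOrder z → z ^ m = 1 := fun z hz => by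
    have := pow_card_eq_one' (G := CommGroup.torsion Z) (x := ⟨z, hz⟩)
    exact congrArg Subtype.val this
  -- If z^m is the image of a torsion element, then z is torsion and z^m = 1, as m is the order of
  -- the torsion of Z. So the m-th powers of Z form a subgroup to which `hmax` applies, and the
  -- center of G/K has exponent m.
  have hA : ((powMonoidHom m : Z →* Z).range.map Z.subtype) = ⊥ := by
    refine hmax _ ⟨?_⟩ ?_
    · rintro _ ⟨z, hz, rfl⟩ y
      refine ⟨z, hz, ?_⟩
      have := Subgroup.mem_center_iff.mp z.2 y
      rw [Subgroup.subtype_apply, this, mul_inv_cancel_right]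
    · rintro x hx ⟨_, ⟨z, rfl⟩, hzx⟩
      have h1 : IsOfFinOrder (z ^ m) := by
        rw [← Submonoid.isOfFinOrder_coe]
        have h2 : IsOfFinOrder (x : G ⧸ K) := (QuotientGroup.mk' K).isOfFinOrder hx
        rw [← hzx] at h2
        exact h2
      have h2 := hZm z (h1.of_pow hm.ne')
      rw [← hzx, powMonoidHom_apply, h2]
      simp
  have hfin : Finite (G ⧸ K) := finite_of_center_pow_eq_one _ hm fun z hz => by
    have : z ^ m ∈ ((powMonoidHom m : Z →* Z).range.map Z.subtype) :=
      ⟨⟨z, hz⟩ ^ m, ⟨⟨z, hz⟩, rfl⟩, rfl⟩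
    rwa [hA] at this
  exact Subgroup.index_ne_zero_of_finite

end IndexBound

/-! ### Polynomials separating elements of infinite order from 1 -/

section Separation

/-- Coordinates on a torsion-free abelian factor `M / N`. -/
theorem exists_coordinates {G : Type u} [Group G] {M N : Subgroup G} (hM : M.FG)
    (hcomm : ∀ x ∈ M, ∀ y ∈ M, ⁅x, y⁆ ∈ N)
    (htf : ∀ x ∈ M, ∀ k, 0 < k → x ^ k ∈ N → x ∈ N) :
    ∃ (r : ℕ) (α : Fin r → G → ℤ) (t : Fin r → G), (∀ i, t i ∈ M) ∧
      (∀ i, ∀ x ∈ M, ∀ y ∈ M, α i (x * y) = α i x + α i y) ∧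
      (∀ i l, α i (t l) = if i = l then 1 else 0) ∧
      ∀ x ∈ M, x ∈ N ↔ ∀ i, α i x = 0 := by
  classical
  have hfg : Group.FG M := (Group.fg_iff_subgroup_fg M).mpr hM
  have hnor : (N.subgroupOf M).Normal := ⟨fun x hx y => by
    rw [Subgroup.mem_subgroupOf] at hx ⊢
    have h1 : ((y * x * y⁻¹ : M) : G) = ⁅(y : G), (x : G)⁆ * x := by
      rw [commutatorElement_def]; simp
    rw [h1]
    exact mul_mem (hcomm y y.2 x x.2) hx⟩
  let Q := M ⧸ N.subgroupOf M
  have hQcomm : ∀ x y : M ⧸ N.subgroupOf M, x * y = y * x := by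
    intro x y
    obtain ⟨x, rfl⟩ := QuotientGroup.mk_surjective x
    obtain ⟨y, rfl⟩ := QuotientGroup.mk_surjective y
    exact mk_commute (Subgroup.mem_subgroupOf.mpr (hcomm x x.2 y y.2))
  let _ : CommGroup Q := { (inferInstance : Group (M ⧸ N.subgroupOf M)) with
    mul_comm := hQcomm }
  have hQfg : Group.FG Q := QuotientGroup.fg (N.subgroupOf M)
  have hQfin : Module.Finite ℤ (Additive Q) := Module.Finite.iff_addGroup_fg.mpr inferInstance
  have hQtf : IsMulTorsionFree Q := by
    refine ⟨fun k hk x y hxy => ?_⟩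
    have h1 : (x / y) ^ k = 1 := by
      rw [div_pow, div_eq_one]; exact hxy
    rw [← div_eq_one]
    obtain ⟨z, hz⟩ := QuotientGroup.mk_surjective (x / y)
    rw [← hz] at h1 ⊢
    have h2 : (z ^ k) ∈ N.subgroupOf M := mem_of_mk_eq_one h1
    exact mk_eq_one_of_mem (Subgroup.mem_subgroupOf.mpr
      (htf z z.2 k (Nat.pos_of_ne_zero hk) (by simpa [Subgroup.mem_subgroupOf] using h2)))
  have hfree : Module.Free ℤ (Additive Q) := Module.free_of_finite_type_torsion_free'
  let b := Module.finBasis ℤ (Additive Q)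
  have hsurj : ∀ i, ∃ x : M, Additive.ofMul (QuotientGroup.mk x : Q) = b i := fun i => by
    obtain ⟨x, hx⟩ := QuotientGroup.mk_surjective (b i).toMul
    exact ⟨x, congrArg Additive.ofMul hx⟩
  choose t ht using hsurj
  let α : Fin (Module.finrank ℤ (Additive Q)) → G → ℤ := fun i x =>
    if h : x ∈ M then b.repr (Additive.ofMul (QuotientGroup.mk ⟨x, h⟩ : Q)) i else 0
  have hα : ∀ i (x : M), α i x = b.repr (Additive.ofMul (QuotientGroup.mk x : Q)) i :=
    fun i x => by simp [α]
  refine ⟨_, α, fun i => t i, fun i => (t i).2, ?_, ?_, ?_⟩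
  · intro i x hx y hy
    have h1 := hα i (⟨x, hx⟩ * ⟨y, hy⟩)
    rw [QuotientGroup.mk_mul, ofMul_mul, map_add, Finsupp.add_apply, ← hα, ← hα] at h1
    exact h1
  · intro i l
    rw [hα, ht, Module.Basis.repr_self, Finsupp.single_apply]
    simp only [eq_comm]
  · intro x hx
    have h1 : x ∈ N ↔ (QuotientGroup.mk ⟨x, hx⟩ : Q) = 1 := by
      rw [QuotientGroup.eq_one_iff, Subgroup.mem_subgroupOf]
    rw [h1, ← ofMul_eq_zero, ← b.repr.map_eq_zero_iff, Finsupp.ext_iff]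
    simp only [← hα, Finsupp.zero_apply]

theorem PolyOn.exists_extend_step {G : Type u} [Group G] [Group.FG G] [Group.IsNilpotent G]
    {j k : ℕ} {r : ℕ} {α : Fin r → G → ℤ} {t : Fin r → G}
    (ht : ∀ i, t i ∈ isolatorFiltration G j)
    (hα : ∀ i, ∀ x ∈ isolatorFiltration G j, ∀ y ∈ isolatorFiltration G j,
      α i (x * y) = α i x + α i y)
    (hαt : ∀ i l, α i (t l) = if i = l then 1 else 0)
    (hmem : ∀ x ∈ isolatorFiltration G j,
      x ∈ isolatorFiltration G (j + 1) ↔ ∀ i, α i x = 0)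
    {f : G → ℤ} (hf : PolyOn (isolatorFiltration G) (isolatorFiltration G (j + 1)) k f) :
    ∃ F, PolyOn (isolatorFiltration G) (isolatorFiltration G j) k F ∧
      ∀ x ∈ isolatorFiltration G (j + 1), F x = f x := by
  have hΓ := isolatorFiltration_isFiltration G
  set Γ := isolatorFiltration G
  have hle : Γ (j + 1) ≤ Γ j := hΓ.antitone (Nat.le_succ j)
  have hα1 : ∀ i, α i 1 = 0 := fun i => by simpa using hα i 1 (one_mem _) 1 (one_mem _)
  -- N s is cut out by the coordinates from s on, so N (s + 1) is N s extended by ⟨t s⟩ and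
  -- `PolyOn.extend` climbs one coordinate at a time.
  let N : ℕ → Subgroup G := fun s =>
    { carrier := {x | x ∈ Γ j ∧ ∀ i : Fin r, s ≤ i → α i x = 0}
      mul_mem' := fun {x y} hx hy => ⟨mul_mem hx.1 hy.1, fun i hi => by
        rw [hα i x hx.1 y hy.1, hx.2 i hi, hy.2 i hi, add_zero]⟩
      one_mem' := ⟨one_mem _, fun i _ => hα1 i⟩
      inv_mem' := fun {x} hx => ⟨inv_mem hx.1, fun i hi => by
        have := hα i x hx.1 _ (inv_mem hx.1)
        rw [mul_inv_cancel, hα1, hx.2 i hi] at this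
        omega⟩ }
  have hN : ∀ s x, x ∈ N s ↔ x ∈ Γ j ∧ ∀ i : Fin r, s ≤ i → α i x = 0 := fun _ _ => Iff.rfl
  have hN0 : N 0 = Γ (j + 1) := by
    ext x
    rw [hN]
    refine ⟨fun h => (hmem x h.1).mpr fun i => h.2 i (Nat.zero_le _), fun h =>
      ⟨hle h, fun i _ => (hmem x (hle h)).mp h i⟩⟩
  have hNr : N r = Γ j := by
    ext x
    rw [hN]
    exact ⟨fun h => h.1, fun h => ⟨h, fun i hi => absurd i.is_lt (not_lt.mpr hi)⟩⟩
  have key : ∀ s ≤ r, ∃ F, PolyOn Γ (N s) k F ∧ ∀ x ∈ Γ (j + 1), F x = f x := by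
    intro s
    induction s with
    | zero => exact fun _ => ⟨f, by rwa [hN0], fun _ _ => rfl⟩
    | succ s ih =>
      intro hs
      obtain ⟨F, hF, hFf⟩ := ih (by omega)
      let i₀ : Fin r := ⟨s, hs⟩
      have hsub : N s ≤ N (s + 1) := fun x hx => ⟨hx.1, fun i hi => hx.2 i (by omega)⟩
      refine ⟨_, hF.extend hΓ hsub (α := α i₀) (t := t i₀) (w := j)
        (fun x hx y hy => hα i₀ x hx.1 y hy.1) (fun x hx => ⟨fun h => h.2 i₀ le_rfl, fun h =>
          ⟨hx.1, fun i hi => ?_⟩⟩) ⟨ht i₀, fun i hi => ?_⟩ (by rw [hαt, if_pos rfl]) (ht i₀)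
          (fun x _ hx' => ?_), fun x hx => ?_⟩
      · rcases hi.eq_or_lt with hi | hi
        · rwa [← show i₀ = i from Fin.ext hi]
        · exact hx.2 i hi
      · rw [hαt, if_neg]
        rintro rfl
        exact absurd hi (by simp [i₀])
      · exact ⟨hle hx', fun i _ => (hmem x (hle hx')).mp hx' i⟩
      · simp only [(hmem x (hle hx)).mp hx i₀, neg_zero, zpow_zero, mul_one]
        exact hFf x hx
  obtain ⟨F, hF, hFf⟩ := key r le_rfl
  exact ⟨F, by rwa [hNr] at hF, hFf⟩

theorem exists_isolatorFiltration_coordinates (G : Type u) [Group G] [Group.FG G]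
    [Group.IsNilpotent G] {j : ℕ} (hj : 1 ≤ j) :
    ∃ (r : ℕ) (α : Fin r → G → ℤ) (t : Fin r → G), (∀ i, t i ∈ isolatorFiltration G j) ∧
      (∀ i, ∀ x ∈ isolatorFiltration G j, ∀ y ∈ isolatorFiltration G j,
        α i (x * y) = α i x + α i y) ∧
      (∀ i l, α i (t l) = if i = l then 1 else 0) ∧
      ∀ x ∈ isolatorFiltration G j, x ∈ isolatorFiltration G (j + 1) ↔ ∀ i, α i x = 0 :=
  have hΓ := isolatorFiltration_isFiltration G
  exists_coordinates (subgroup_fg G _)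
    (fun x hx y hy => hΓ.antitone (by omega) (hΓ.comm j j x hx y hy))
    fun _ _ _ hk h => mem_isolator_of_pow_mem hk h

theorem PolyOn.exists_extend_top {G : Type u} [Group G] [Group.FG G] [Group.IsNilpotent G]
    {j k : ℕ} (hj : 1 ≤ j) {f : G → ℤ}
    (hf : PolyOn (isolatorFiltration G) (isolatorFiltration G j) k f) :
    ∃ F, PolyOn (isolatorFiltration G) ⊤ k F ∧ ∀ x ∈ isolatorFiltration G j, F x = f x := by
  induction j, hj using Nat.le_induction generalizing f with
  | base => exact ⟨f, by rwa [(isolatorFiltration_isFiltration G).one] at hf, fun _ _ => rfl⟩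
  | succ j hj ih =>
    obtain ⟨r, α, t, ht, hα, hαt, hmem⟩ := exists_isolatorFiltration_coordinates G hj
    obtain ⟨F, hF, hFf⟩ := hf.exists_extend_step ht hα hαt hmem
    obtain ⟨F', hF', hFF'⟩ := ih hF
    exact ⟨F', hF', fun x hx => (hFF' x
      ((isolatorFiltration_isFiltration G).antitone (Nat.le_succ j) hx)).trans (hFf x hx)⟩

/-- Differences by weight at most j are constant and by larger weight zero, so a coordinate of layer
j has degree at most j. -/
theorem polyOn_of_additive {G : Type u} [Group G] {Γ : ℕ → Subgroup G} (hΓ : IsFiltration Γ)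
    {j : ℕ} {α : G → ℤ} (hα : ∀ x ∈ Γ j, ∀ y ∈ Γ j, α (x * y) = α x + α y)
    (h0 : ∀ x ∈ Γ (j + 1), α x = 0) : PolyOn Γ (Γ j) (j + 1) α := by
  refine .of_diff (by omega) fun i hi g hg hgi => ?_
  by_cases hij : i ≤ j
  · exact (PolyOn.const (by omega) (α g)).congr fun x hx => by rw [hα g hg x hx]; ring
  · refine (PolyOn.zero fun x hx => ?_).mono (Nat.zero_le _)
    rw [hα g hg x hx, h0 g (hΓ.antitone (by omega) hgi)]
    ring

/-- Finitely many polynomials of degree at most the class separate the identity from the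
elements of infinite order. -/
theorem exists_separating_polynomials (G : Type u) [Group G] [Group.FG G]
    [Group.IsNilpotent G] :
    ∃ 𝓕 : Set (G → ℤ), 𝓕.Finite ∧ (∀ F ∈ 𝓕, PolyOn (isolatorFiltration G) ⊤
      (Group.nilpotencyClass G + 1) F ∧ F 1 = 0) ∧
      ∀ g, (∀ F ∈ 𝓕, F g = 0) → IsOfFinOrder g := by
  set c := Group.nilpotencyClass G with hc
  -- Once the earlier polynomials force g into the next isolator, the extended coordinates agree on
  -- g with the true ones and push it one layer deeper.
  have key : ∀ j ≤ c, ∃ 𝓕 : Set (G → ℤ), 𝓕.Finite ∧ (∀ F ∈ 𝓕, PolyOn (isolatorFiltration G) ⊤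
      (c + 1) F ∧ F 1 = 0) ∧ ∀ g, (∀ F ∈ 𝓕, F g = 0) → g ∈ isolatorFiltration G (j + 1) := by
    intro j
    induction j with
    | zero =>
      refine fun _ => ⟨∅, Set.finite_empty, by simp, fun g _ => ?_⟩
      rw [zero_add, (isolatorFiltration_isFiltration G).one]
      trivial
    | succ j ih =>
      intro hj
      obtain ⟨𝓕, hfin, hpoly, hsep⟩ := ih (by omega)
      obtain ⟨r, α, t, ht, hα, hαt, hmem⟩ :=
        exists_isolatorFiltration_coordinates G (j := j + 1) (by omega)
      have hext : ∀ i, ∃ F, PolyOn (isolatorFiltration G) ⊤ (j + 1 + 1) F ∧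
          ∀ x ∈ isolatorFiltration G (j + 1), F x = α i x := fun i =>
        (polyOn_of_additive (isolatorFiltration_isFiltration G) (hα i) fun x hx =>
          (hmem x ((isolatorFiltration_isFiltration G).antitone (Nat.le_succ _) hx)).mp hx
            i).exists_extend_top (by omega)
      choose F hF hFα using hext
      refine ⟨𝓕 ∪ Set.range F, hfin.union (Set.finite_range F), ?_, fun g hg => ?_⟩
      · rintro f (hf | ⟨i, rfl⟩)
        · exact hpoly f hf
        · refine ⟨(hF i).mono (by omega), ?_⟩
          rw [hFα i 1 (one_mem _)]
          simpa using hα i 1 (one_mem _) 1 (one_mem _)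
      · have hg' := hsep g fun f hf => hg f (Or.inl hf)
        rw [hmem g hg']
        intro i
        rw [← hFα i g hg']
        exact hg _ (Or.inr ⟨i, rfl⟩)
  obtain ⟨𝓕, hfin, hpoly, hsep⟩ := key c le_rfl
  exact ⟨𝓕, hfin, hpoly, fun g hg => isOfFinOrder_of_mem_isolatorFiltration (hsep g hg)⟩

end Separation

/-! ### Word balls and the upper bound -/

section WordBall

variable {G : Type u} [Group G] {X : Set G}

theorem one_mem_wordBall (n : ℕ) : (1 : G) ∈ wordBall X n := ⟨[], by simp, by simp, rfl⟩

theorem wordBall_mono {m n : ℕ} (h : m ≤ n) : wordBall X m ⊆ wordBall X n :=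
  fun _ ⟨l, hl, hX, hg⟩ => ⟨l, hl.trans h, hX, hg⟩

theorem mul_mem_wordBall {m n : ℕ} {g h : G} (hg : g ∈ wordBall X m) (hh : h ∈ wordBall X n) :
    g * h ∈ wordBall X (m + n) := by
  obtain ⟨l, hl, hlX, rfl⟩ := hg
  obtain ⟨l', hl', hlX', rfl⟩ := hh
  refine ⟨l ++ l', by rw [List.length_append]; omega, fun x hx => ?_, List.prod_append⟩
  exact (List.mem_append.mp hx).elim (hlX x) (hlX' x)

theorem inv_mem_wordBall {n : ℕ} {g : G} (hg : g ∈ wordBall X n) : g⁻¹ ∈ wordBall X n := by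
  obtain ⟨l, hl, hlX, rfl⟩ := hg
  refine ⟨(l.map (·⁻¹)).reverse, by simpa using hl, fun x hx => ?_, (List.prod_inv_reverse l).symm⟩
  obtain ⟨y, hy, rfl⟩ : ∃ y ∈ l, y⁻¹ = x := by simpa using hx
  simpa using (hlX y hy).symm

theorem exists_mem_wordBall (hX : Subgroup.closure X = ⊤) (g : G) : ∃ n, g ∈ wordBall X n := by
  have hg : g ∈ Subgroup.closure X := by rw [hX]; trivial
  induction hg using Subgroup.closure_induction with
  | mem x hx => exact ⟨1, [x], by simp, by simpa using Or.inl hx, by simp⟩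
  | one => exact ⟨0, one_mem_wordBall 0⟩
  | mul x y _ _ hx hy =>
    obtain ⟨m, hm⟩ := hx
    obtain ⟨n, hn⟩ := hy
    exact ⟨m + n, mul_mem_wordBall hm hn⟩
  | inv x _ hx =>
    obtain ⟨n, hn⟩ := hx
    exact ⟨n, inv_mem_wordBall hn⟩

theorem pow_mem_wordBall {m : ℕ} {g : G} (hg : g ∈ wordBall X m) (k : ℕ) :
    g ^ k ∈ wordBall X (m * k) := by
  induction k with
  | zero => simpa using one_mem_wordBall 0
  | succ k ih =>
    rw [pow_succ, Nat.mul_succ]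
    exact mul_mem_wordBall ih hg

theorem fullyDetects_quotient {S : Set G} (K : Subgroup G) [K.Normal] (hK : K.index ≠ 0)
    (hS : ∀ g ∈ S, ∀ h ∈ S, g⁻¹ * h ∈ K → g⁻¹ * h = 1) :
    ∃ (Q : Type) (_ : Group Q), Finite Q ∧ FullyDetects S Q ∧ Nat.card Q = K.index := by
  have hfin : Finite (G ⧸ K) := Nat.finite_of_card_ne_zero hK
  -- The detecting group must live in `Type`, whatever the universe of G.
  refine ⟨Shrink.{0} (G ⧸ K), inferInstance, inferInstance,
    ⟨(Shrink.mulEquiv.{0} (α := G ⧸ K)).symm.toMonoidHom.comp (QuotientGroup.mk' K),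
      fun g hg h hh hgh => ?_⟩, Nat.card_congr (equivShrink.{0} (G ⧸ K)).symm⟩
  have h1 : (g : G ⧸ K) = h := (Shrink.mulEquiv.{0} (α := G ⧸ K)).symm.injective hgh
  exact inv_mul_eq_one.mp (hS g hg h hh (QuotientGroup.eq.mp h1))

/-- The finite groups that detect balls and have the order required by the upper bound. -/
theorem CyclicData.exists_fullyDetects [Group.FG G] [Group.IsNilpotent G] {n : ℕ}
    {T : ℕ → Subgroup G} {g : ℕ → G} {I : Finset ℕ} {e : ℕ → ℕ} (h : CyclicData n T g I e)
    (hX : X.Finite) :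
    ∃ C : ℕ, ∀ n, 0 < n → ∃ (Q : Type) (_ : Group Q), Finite Q ∧
      FullyDetects (wordBall X n) Q ∧
      Nat.card Q ≤ C * n ^ (Group.nilpotencyClass G * I.card) := by
  have hΓ := isolatorFiltration_isFiltration G
  set c := Group.nilpotencyClass G
  obtain ⟨K₀, hK₀n, hK₀, hK₀t⟩ := exists_torsionFree_normal G
  obtain ⟨𝓕, hfin, hpoly, hsep⟩ := exists_separating_polynomials G
  have hgr : ∀ F : G → ℤ, ∃ C : ℕ, F ∈ 𝓕 → ∀ n : ℕ, ∀ g ∈ wordBall X n,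
      |F g| ≤ C * (n + 1) ^ c := fun F => by
    by_cases hF : F ∈ 𝓕
    · obtain ⟨C, hC⟩ := (hpoly F hF).1.growth hΓ hX
      exact ⟨C, fun _ => hC⟩
    · exact ⟨0, fun h => absurd h hF⟩
  choose C hC using hgr
  set D := ∑ F ∈ hfin.toFinset, C F
  have hD : ∀ F ∈ 𝓕, ∀ n : ℕ, ∀ g ∈ wordBall X n, |F g| ≤ D * (n + 1) ^ c := fun F hF n g hg => by
    refine (hC F hF n g hg).trans ?_
    have : C F ≤ D := Finset.single_le_sum (f := C) (fun _ _ => Nat.zero_le _) (by simpa using hF)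
    gcongr
  obtain ⟨B, hB⟩ := h.index_powSubgroup
  refine ⟨K₀.index * (B * ((D + 1) * 3 ^ c * (c + 1).factorial) ^ I.card), fun n hn => ?_⟩
  -- Quotients of two elements of the ball have length at most 2n, and 2n + 1 ≤ 3n. So m exceeds
  -- every value |F| there, and a value divisible by m is 0.
  set m := D * (3 * n) ^ c + 1 with hm
  have hmpos : 0 < m * (c + 1).factorial := Nat.mul_pos (Nat.succ_pos _) (Nat.factorial_pos _)
  obtain ⟨hL, hLle⟩ := hB _ hmpos
  set L := powSubgroup G (m * (c + 1).factorial) with hLdef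
  obtain ⟨Q, hQ, hQfin, hdet, hcard⟩ := fullyDetects_quotient (S := wordBall X n) (K₀ ⊓ L)
    (Subgroup.index_inf_ne_zero hK₀ hL) fun g hg h hh hgh => by
      refine hK₀t _ hgh.1 (hsep _ fun F hF => ?_)
      have h1 := hD F hF _ _ (mul_mem_wordBall (inv_mem_wordBall hg) hh)
      have h2 := (hpoly F hF).1.dvd_sub_of_mem_closure hΓ m hgh.2 1
      rw [mul_one, (hpoly F hF).2, sub_zero] at h2
      refine Int.eq_zero_of_abs_lt_dvd h2 (h1.trans_lt ?_)
      rw [hm]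
      have h3 : ((n + n : ℕ) : ℤ) + 1 ≤ 3 * n := by push_cast; omega
      push_cast at h3 ⊢
      refine Int.lt_add_one_of_le ?_
      gcongr
  refine ⟨Q, hQ, hQfin, hdet, hcard.le.trans (Subgroup.index_inf_le.trans ?_)⟩
  rw [mul_assoc]
  refine Nat.mul_le_mul_left _ (hLle.trans ?_)
  rw [mul_assoc, pow_mul, ← mul_pow]
  refine Nat.mul_le_mul_left _ (Nat.pow_le_pow_left ?_ _)
  have h1 : 1 ≤ (3 * n) ^ c := Nat.one_le_pow _ _ (by omega)
  calc m * (c + 1).factorial ≤ ((D + 1) * (3 * n) ^ c) * (c + 1).factorial := by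
        refine Nat.mul_le_mul_right _ ?_
        rw [hm, add_mul, one_mul]
        omega
    _ = _ := by rw [mul_pow]; ring

end WordBall

/-! ### Distortion of the lower central series -/

section Distortion

variable {G : Type u} [Group G] {X : Set G}

theorem commutator_mem_wordBall {m n : ℕ} {g h : G} (hg : g ∈ wordBall X m)
    (hh : h ∈ wordBall X n) : ⁅g, h⁆ ∈ wordBall X (2 * (m + n)) := by
  rw [commutatorElement_def, show 2 * (m + n) = m + n + m + n by ring]
  exact mul_mem_wordBall (mul_mem_wordBall (mul_mem_wordBall hg hh) (inv_mem_wordBall hg))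
    (inv_mem_wordBall hh)

/-- Powers `g ^ a` with `a ≤ n ^ (i + 1)` of an element of the term with index `i` of the lower
central series have, modulo the next term, length at most linear in `n`. -/
theorem exists_wordBall_pow_lowerCentralSeries (hX : Subgroup.closure X = ⊤) (i : ℕ) {g : G}
    (hg : g ∈ (⊤ : Subgroup G).lowerCentralSeries i) :
    ∃ C : ℕ, ∀ n, 0 < n → ∀ a ≤ n ^ (i + 1), ∃ y ∈ wordBall X (C * n),
      (y : G ⧸ (⊤ : Subgroup G).lowerCentralSeries (i + 1)) =
        (g : G ⧸ (⊤ : Subgroup G).lowerCentralSeries (i + 1)) ^ a := by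
  induction i generalizing g with
  | zero =>
    obtain ⟨C, hC⟩ := exists_mem_wordBall hX g
    refine ⟨C, fun n _ a ha => ⟨g ^ a, wordBall_mono (Nat.mul_le_mul_left _ ?_)
      (pow_mem_wordBall hC a), QuotientGroup.mk_pow _ _ _⟩⟩
    simpa using ha
  | succ i ih =>
    set N := (⊤ : Subgroup G).lowerCentralSeries (i + 1 + 1)
    have hcentral : ∀ z ∈ (⊤ : Subgroup G).lowerCentralSeries (i + 1), ∀ x : G ⧸ N,
        Commute (z : G ⧸ N) x := fun z hz x => by
      obtain ⟨x, rfl⟩ := QuotientGroup.mk_surjective x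
      exact mk_commute (Subgroup.commutator_mem_commutator hz (Subgroup.mem_top x))
    rw [Subgroup.mem_lowerCentralSeries_succ_iff] at hg
    induction hg using Subgroup.closure_induction with
    | mem s hs =>
      obtain ⟨p, hp, q, hq, rfl⟩ := hs
      have hpq : ⁅p, q⁆ ∈ (⊤ : Subgroup G).lowerCentralSeries (i + 1) :=
        Subgroup.commutator_mem_commutator hp hq
      obtain ⟨C, hC⟩ := ih hp
      obtain ⟨P, hP⟩ := exists_mem_wordBall hX p
      obtain ⟨R, hR⟩ := exists_mem_wordBall hX q
      refine ⟨2 * (C + R) + 2 * (P + R), fun n hn a ha => ?_⟩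
      have hb : a / n ≤ n ^ (i + 1) := by
        refine Nat.div_le_of_le_mul ?_
        rwa [← pow_succ']
      have hr : a % n ≤ n := (Nat.mod_lt a hn).le
      obtain ⟨y, hy, hyp⟩ := hC n hn (a / n) hb
      -- Modulo N the commutator is bilinear here, and a = (a / n)·n + a % n. The power p^(a / n) is
      -- replaced by its short representative y, which does not change the commutator modulo N.
      refine ⟨⁅y, q ^ n⁆ * ⁅p, q ^ (a % n)⁆, ?_, ?_⟩
      · refine wordBall_mono ?_ (mul_mem_wordBall
          (commutator_mem_wordBall hy (pow_mem_wordBall hR n))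
          (commutator_mem_wordBall hP (pow_mem_wordBall hR (a % n))))
        have h1 : R * (a % n) ≤ R * n := Nat.mul_le_mul_left _ hr
        have h2 : P ≤ P * n := Nat.le_mul_of_pos_right _ hn
        rw [add_mul, mul_assoc, mul_assoc, add_mul, add_mul]
        omega
      · have hc : ∀ x, Commute ⁅(p : G ⧸ N), (q : G ⧸ N)⁆ x := by
          rw [← mk_commutatorElement]
          exact hcentral _ hpq
        have h1 : ((⁅y, q ^ n⁆ : G) : G ⧸ N) = (⁅p ^ (a / n), q ^ n⁆ : G) := by
          rw [← QuotientGroup.mk_pow, eq_comm, QuotientGroup.eq] at hyp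
          have h2 : ⁅y, q ^ n⁆ = p ^ (a / n) * ⁅(p ^ (a / n))⁻¹ * y, q ^ n⁆ * (p ^ (a / n))⁻¹ *
              ⁅p ^ (a / n), q ^ n⁆ := by
            rw [← commutatorElement_mul_left_eq_conj_mul, mul_inv_cancel_left]
          have h3 : ((p ^ (a / n) * ⁅(p ^ (a / n))⁻¹ * y, q ^ n⁆ * (p ^ (a / n))⁻¹ : G) : G ⧸ N)
              = 1 := mk_eq_one_of_mem (Subgroup.Normal.conj_mem inferInstance _
                (Subgroup.commutator_mem_commutator hyp (Subgroup.mem_top _)) _)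
          rw [h2, QuotientGroup.mk_mul, h3, one_mul]
        have h4 := commutatorElement_pow_pow hc 1 (a % n)
        rw [pow_one, one_mul] at h4
        rw [QuotientGroup.mk_mul, h1, mk_commutatorElement, mk_commutatorElement,
          mk_commutatorElement, QuotientGroup.mk_pow, QuotientGroup.mk_pow, QuotientGroup.mk_pow,
          commutatorElement_pow_pow hc, h4, ← pow_add, Nat.div_add_mod']
    | one => exact ⟨0, fun n _ a _ => ⟨1, one_mem_wordBall _, by
        rw [QuotientGroup.mk_one, one_pow]⟩⟩
    | mul x y hx' _ hx hy =>
      obtain ⟨C, hC⟩ := hx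
      obtain ⟨D, hD⟩ := hy
      refine ⟨C + D, fun n hn a ha => ?_⟩
      obtain ⟨x', hx1, hx2⟩ := hC n hn a ha
      obtain ⟨y', hy1, hy2⟩ := hD n hn a ha
      refine ⟨x' * y', by rw [add_mul]; exact mul_mem_wordBall hx1 hy1, ?_⟩
      rw [QuotientGroup.mk_mul, QuotientGroup.mk_mul, hx2, hy2, (hcentral x
        ((Subgroup.mem_lowerCentralSeries_succ_iff _ _ _).mpr hx') y).mul_pow]
    | inv x _ hx =>
      obtain ⟨C, hC⟩ := hx
      refine ⟨C, fun n hn a ha => ?_⟩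
      obtain ⟨x', hx1, hx2⟩ := hC n hn a ha
      exact ⟨x'⁻¹, inv_mem_wordBall hx1, by
        rw [QuotientGroup.mk_inv, QuotientGroup.mk_inv, hx2, inv_pow]⟩

/-- The power by the relative index lands in γ_c; the next lower central term is trivial, so the
congruence of the distortion lemma becomes an equality. -/
theorem exists_wordBall_zpow_center [Group.IsNilpotent G] (hX : Subgroup.closure X = ⊤)
    (hc : Group.nilpotencyClass G ≠ 0)
    (hZ : (lastLowerCentral G).relIndex (Subgroup.center G) ≠ 0) {u : G}
    (hu : u ∈ Subgroup.center G) :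
    ∃ C : ℕ, ∀ n, 0 < n → ∀ a : ℤ, a.natAbs ≤ n ^ Group.nilpotencyClass G →
      (u ^ (lastLowerCentral G).relIndex (Subgroup.center G)) ^ a ∈ wordBall X (C * n) := by
  set N := (lastLowerCentral G).relIndex (Subgroup.center G)
  have hnor : ((lastLowerCentral G).subgroupOf (Subgroup.center G)).Normal :=
    Subgroup.Normal.subgroupOf (inferInstanceAs ((⊤ : Subgroup G).lowerCentralSeries _).Normal) _
  have huN : u ^ N ∈ (⊤ : Subgroup G).lowerCentralSeries (Group.nilpotencyClass G - 1) := by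
    have := Subgroup.pow_index_mem ((lastLowerCentral G).subgroupOf (Subgroup.center G)) ⟨u, hu⟩
    rwa [Subgroup.mem_subgroupOf] at this
  obtain ⟨C, hC⟩ := exists_wordBall_pow_lowerCentralSeries hX _ huN
  rw [show Group.nilpotencyClass G - 1 + 1 = Group.nilpotencyClass G by omega] at hC
  have key : ∀ n, 0 < n → ∀ a : ℕ, a ≤ n ^ Group.nilpotencyClass G →
      (u ^ N) ^ a ∈ wordBall X (C * n) := by
    intro n hn a ha
    obtain ⟨y, hy, hyu⟩ := hC n hn a ha
    rw [← QuotientGroup.mk_pow, QuotientGroup.eq, Subgroup.lowerCentralSeries_nilpotencyClass,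
      Subgroup.mem_bot, inv_mul_eq_one] at hyu
    rwa [← hyu]
  refine ⟨C, fun n hn a ha => ?_⟩
  rcases Int.natAbs_eq a with h | h
  · rw [h, zpow_natCast]
    exact key n hn _ ha
  · rw [h, zpow_neg, zpow_natCast]
    exact inv_mem_wordBall (key n hn _ ha)

end Distortion

/-! ### Central detectors and the lower bound -/

section LowerBound

variable {G : Type u} [Group G] {X : Set G}

/-- A map that is given by iterated commutators and that induces a homomorphism from a factor of
the upper central series to the center. -/
structure IsCentralDetector (k : ℕ) (ψ : G → G) : Prop where
  center : ∀ x ∈ Subgroup.upperCentralSeries G (k + 1), ψ x ∈ Subgroup.center G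
  mul : ∀ x ∈ Subgroup.upperCentralSeries G (k + 1),
    ∀ y ∈ Subgroup.upperCentralSeries G (k + 1), ψ (x * y) = ψ x * ψ y
  eq_one : ∀ x ∈ Subgroup.upperCentralSeries G k, ψ x = 1
  normal : ∀ K : Subgroup G, K.Normal → ∀ x ∈ K, ψ x ∈ K

/-- On the upper central term k + 2, the map x ↦ [x, t] is multiplicative up to [x, [y, t]], which
lies in term k and is killed by ψ; the order of the factors is immaterial after ψ. -/
theorem IsCentralDetector.commutator {k : ℕ} {ψ : G → G} (h : IsCentralDetector k ψ) (t : G) :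
    IsCentralDetector (k + 1) (fun x => ψ ⁅x, t⁆) where
  center x hx := h.center _ (hx t)
  mul x hx y hy := by
    have hw : ⁅y, t⁆ ∈ Subgroup.upperCentralSeries G (k + 1) := hy t
    have h1 : ⁅x, ⁅y, t⁆⁆ ∈ Subgroup.upperCentralSeries G k := by
      rw [← commutatorElement_inv]
      exact inv_mem (hw x)
    have h2 : ⁅x * y, t⁆ = ⁅x, ⁅y, t⁆⁆ * (⁅y, t⁆ * ⁅x, t⁆) := by
      simp only [commutatorElement_def]
      group
    rw [h2, h.mul _ (Subgroup.upperCentralSeries_mono G (Nat.le_succ k) h1) _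
      (mul_mem hw (hx t)), h.eq_one _ h1, one_mul, h.mul _ hw _ (hx t)]
    exact Subgroup.mem_center_iff.mp (h.center _ (hx t)) _
  eq_one x hx := h.eq_one _ (hx t)
  normal K hK x hx := h.normal K hK _ (by
    rw [commutatorElement_def, mul_assoc, mul_assoc, ← mul_assoc t]
    exact mul_mem hx (hK.conj_mem _ (inv_mem hx) t))

/-- Membership in an upper central term can be tested by commutators with generators alone, so
finitely many iterated commutators suffice. -/
theorem exists_centralDetectors (hXfin : X.Finite) (hX : Subgroup.closure X = ⊤) (k : ℕ) :
    ∃ 𝓕 : Set (G → G), 𝓕.Finite ∧ (∀ ψ ∈ 𝓕, IsCentralDetector k ψ) ∧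
      ∀ x ∈ Subgroup.upperCentralSeries G (k + 1), (∀ ψ ∈ 𝓕, ψ x = 1) →
        x ∈ Subgroup.upperCentralSeries G k := by
  induction k with
  | zero =>
    refine ⟨{id}, Set.finite_singleton _, ?_, fun x _ h => ?_⟩
    · rintro _ rfl
      exact ⟨fun x hx => by rwa [zero_add, Subgroup.upperCentralSeries_one] at hx,
        fun _ _ _ _ => rfl, fun x hx => by simpa using hx, fun _ _ _ hx => hx⟩
    · rw [Subgroup.upperCentralSeries_zero, Subgroup.mem_bot]
      exact h id rfl
  | succ k ih =>
    obtain ⟨𝓕, hfin, hdet, hsep⟩ := ih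
    refine ⟨Set.image2 (fun ψ t x => ψ ⁅x, t⁆) 𝓕 X, hfin.image2 _ hXfin, ?_, fun x hx h => ?_⟩
    · rintro _ ⟨ψ, hψ, t, -, rfl⟩
      exact (hdet ψ hψ).commutator t
    · exact commutator_mem_of_closure (L := Subgroup.upperCentralSeries G k) hX fun t ht =>
        hsep _ (hx t) fun ψ hψ => h _ ⟨ψ, hψ, t, ht, rfl⟩

theorem IsCentralDetector.pow {k : ℕ} {ψ : G → G} (h : IsCentralDetector k ψ) {x : G}
    (hx : x ∈ Subgroup.upperCentralSeries G (k + 1)) (a : ℕ) : ψ (x ^ a) = ψ x ^ a := by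
  induction a with
  | zero => simpa using h.eq_one 1 (one_mem _)
  | succ a ih => rw [pow_succ, h.mul _ (pow_mem hx a) _ hx, ih, pow_succ]

theorem IsCentralDetector.mul_inv {k : ℕ} {ψ : G → G} (h : IsCentralDetector k ψ) {x y : G}
    (hx : x ∈ Subgroup.upperCentralSeries G (k + 1))
    (hy : y ∈ Subgroup.upperCentralSeries G (k + 1)) : ψ (x * y⁻¹) = ψ x * (ψ y)⁻¹ := by
  rw [eq_mul_inv_iff_mul_eq, ← h.mul _ (mul_mem hx (inv_mem hy)) _ hy, inv_mul_cancel_right]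

/-- The product `g i ^ a i * g (i + 1) ^ a (i + 1) * ⋯` with `len` factors. -/
def tailProd (g : ℕ → G) (a : ℕ → ℕ) : ℕ → ℕ → G
  | _, 0 => 1
  | i, len + 1 => g i ^ a i * tailProd g a (i + 1) len

theorem tailProd_mem {g : ℕ → G} {T : ℕ → Subgroup G} (hT : Antitone T) (hg : ∀ i, g i ∈ T i)
    (a : ℕ → ℕ) (i len : ℕ) : tailProd g a i len ∈ T i := by
  induction len generalizing i with
  | zero => exact one_mem _
  | succ len ih => exact mul_mem (pow_mem (hg i) _) (hT (Nat.le_succ i) (ih (i + 1)))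

/-- The values of ψ are central, so the expression is the product of the (ψ (g j)^N)^(a j - b j).
Only these factors need to be short, not the tail products. -/
theorem IsCentralDetector.tailProd_mem_wordBall {k : ℕ} {ψ : G → G} (h : IsCentralDetector k ψ)
    {g : ℕ → G} {a b : ℕ → ℕ} {N M R : ℕ} (hab : ∀ j, ((a j : ℤ) - b j).natAbs ≤ M) {i : ℕ}
    (hg : ∀ j, i ≤ j → g j ∈ Subgroup.upperCentralSeries G (k + 1)) {len : ℕ}
    (hR : ∀ j, i ≤ j → j < i + len → ∀ e : ℤ, e.natAbs ≤ M → (ψ (g j) ^ N) ^ e ∈ wordBall X R) :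
    (ψ (tailProd g a i len) * (ψ (tailProd g b i len))⁻¹) ^ N ∈ wordBall X (len * R) := by
  have hmem : ∀ (a : ℕ → ℕ) (i len : ℕ),
      (∀ j, i ≤ j → g j ∈ Subgroup.upperCentralSeries G (k + 1)) →
      tailProd g a i len ∈ Subgroup.upperCentralSeries G (k + 1) := by
    intro a i len
    induction len generalizing i with
    | zero => exact fun _ => one_mem _
    | succ len ih =>
      exact fun hg => mul_mem (pow_mem (hg i le_rfl) _) (ih (i + 1) fun j hj => hg j (by omega))
  induction len generalizing i with
  | zero => simpa [tailProd] using one_mem_wordBall 0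
  | succ len ih =>
    have h1 := ih (i := i + 1) (fun j hj => hg j (by omega)) fun j hij hj => hR j (by omega) (by omega)
    have hgi := hg i le_rfl
    have hc := h.center _ hgi
    have hmem' : ∀ a, tailProd g a (i + 1) len ∈ Subgroup.upperCentralSeries G (k + 1) :=
      fun a => hmem a (i + 1) len fun j hj => hg j (by omega)
    have h2 : ψ (tailProd g a i (len + 1)) * (ψ (tailProd g b i (len + 1)))⁻¹ =
        ψ (g i) ^ ((a i : ℤ) - b i) *
          (ψ (tailProd g a (i + 1) len) * (ψ (tailProd g b (i + 1) len))⁻¹) := by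
      have hz := Subgroup.mem_center_iff.mp (inv_mem (pow_mem hc (b i)))
        (ψ (tailProd g a (i + 1) len) * (ψ (tailProd g b (i + 1) len))⁻¹)
      rw [tailProd, tailProd, h.mul _ (pow_mem hgi _) _ (hmem' a),
        h.mul _ (pow_mem hgi _) _ (hmem' b), h.pow hgi, h.pow hgi, zpow_sub, zpow_natCast,
        zpow_natCast, mul_inv_rev, mul_assoc, mul_assoc, ← hz]
      simp only [mul_assoc]
    have hcomm : Commute (ψ (g i) ^ ((a i : ℤ) - b i))
        (ψ (tailProd g a (i + 1) len) * (ψ (tailProd g b (i + 1) len))⁻¹) :=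
      (Subgroup.mem_center_iff.mp (zpow_mem hc _) _).symm
    have h3 : (ψ (g i) ^ ((a i : ℤ) - b i)) ^ N = (ψ (g i) ^ N) ^ ((a i : ℤ) - b i) := by
      rw [← zpow_natCast, ← zpow_mul, mul_comm, zpow_mul, zpow_natCast]
    rw [h2, hcomm.mul_pow, h3, Nat.succ_mul, add_comm]
    exact mul_mem_wordBall (hR i le_rfl (by omega) _ (hab i)) h1

/-- The layer of the upper central series that contains an infinite factor. -/
theorem CyclicData.exists_layer [Group.IsNilpotent G] {n : ℕ} {T : ℕ → Subgroup G} {g : ℕ → G}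
    {I : Finset ℕ} {e : ℕ → ℕ} (h : CyclicData n T g I e) {i : ℕ} (hi : i ∈ I) :
    ∃ k < Group.nilpotencyClass G, Subgroup.upperCentralSeries G k ≤ T (i + 1) ∧
      T i ≤ Subgroup.upperCentralSeries G (k + 1) := by
  classical
  have hne : ¬ (⊤ : Subgroup G) ≤ T (i + 1) := fun htop => by
    have := h.infinite i hi 1 (htop (Subgroup.mem_top _))
    omega
  have hex : ∃ k, ¬ Subgroup.upperCentralSeries G k ≤ T (i + 1) :=
    ⟨Group.nilpotencyClass G, by rwa [Subgroup.upperCentralSeries_nilpotencyClass]⟩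
  have hspec := Nat.find_spec hex
  obtain ⟨k, hk⟩ : ∃ k, Nat.find hex = k + 1 := Nat.exists_eq_succ_of_ne_zero fun h0 => by
    rw [h0] at hspec
    exact hspec bot_le
  have hle : Nat.find hex ≤ Group.nilpotencyClass G :=
    Nat.find_min' hex (by rwa [Subgroup.upperCentralSeries_nilpotencyClass])
  refine ⟨k, by omega, not_not.mp (Nat.find_min hex (m := k) (by omega)), ?_⟩
  rw [hk] at hspec
  -- The upper central term k + 1 is some T j not contained in T (i + 1); hence j ≤ i, which gives
  -- the second inclusion.
  obtain ⟨j, hj⟩ := h.refines (k + 1)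
  rw [← hj] at hspec ⊢
  exact h.antitone (by
    by_contra hji
    exact hspec (h.antitone (by omega)))

/-- The lower bound for the order of a finite group that detects a ball. -/
theorem CyclicData.exists_le_card [Group.IsNilpotent G] {n : ℕ} {T : ℕ → Subgroup G} {g : ℕ → G}
    {I : Finset ℕ} {e : ℕ → ℕ} (h : CyclicData n T g I e) (hXfin : X.Finite)
    (hX : Subgroup.closure X = ⊤) (hc : Group.nilpotencyClass G ≠ 0)
    (hZ : (lastLowerCentral G).relIndex (Subgroup.center G) ≠ 0) :
    ∃ C : ℕ, ∀ m, 0 < m → ∀ (Q : Type) [Group Q] [Finite Q],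
      FullyDetects (wordBall X (C * m)) Q →
      m ^ (Group.nilpotencyClass G * I.card) ≤ Nat.card Q := by
  classical
  set c := Group.nilpotencyClass G
  set N := (lastLowerCentral G).relIndex (Subgroup.center G)
  have hC : ∀ u : G, ∃ C : ℕ, u ∈ Subgroup.center G → ∀ n, 0 < n → ∀ a : ℤ,
      a.natAbs ≤ n ^ c → (u ^ N) ^ a ∈ wordBall X (C * n) := fun u => by
    by_cases hu : u ∈ Subgroup.center G
    · obtain ⟨C, hC⟩ := exists_wordBall_zpow_center hX hc hZ hu
      exact ⟨C, fun _ => hC⟩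
    · exact ⟨0, fun h => absurd h hu⟩
  choose C hC using hC
  choose 𝓕 hfin hdet hsep using exists_centralDetectors (G := G) hXfin hX
  set C₀ := ∑ k ∈ Finset.range c, ∑ ψ ∈ (hfin k).toFinset, ∑ j ∈ Finset.range n, C (ψ (g j))
  have hC₀ : ∀ k < c, ∀ ψ ∈ 𝓕 k, ∀ j < n, C (ψ (g j)) ≤ C₀ := by
    intro k hk ψ hψ j hj
    calc C (ψ (g j)) ≤ ∑ j ∈ Finset.range n, C (ψ (g j)) :=
          Finset.single_le_sum (f := fun j => C (ψ (g j))) (fun _ _ => Nat.zero_le _)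
            (Finset.mem_range.mpr hj)
      _ ≤ ∑ ψ ∈ (hfin k).toFinset, ∑ j ∈ Finset.range n, C (ψ (g j)) :=
          Finset.single_le_sum (f := fun ψ : G → G => ∑ j ∈ Finset.range n, C (ψ (g j)))
            (fun _ _ => Nat.zero_le _) (by simpa using hψ)
      _ ≤ C₀ :=
          Finset.single_le_sum (f := fun k => ∑ ψ ∈ (hfin k).toFinset,
            ∑ j ∈ Finset.range n, C (ψ (g j))) (fun _ _ => Nat.zero_le _)
            (Finset.mem_range.mpr hk)
  -- At most n factors occur, each of length at most C₀ m.
  refine ⟨n * C₀, fun m hm Q _ _ ⟨φ, hφ⟩ => ?_⟩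
  have hker : ∀ x ∈ wordBall X (n * C₀ * m), φ x = 1 → x = 1 := fun x hx hx1 =>
    hφ hx (one_mem_wordBall _) (by rw [hx1, map_one])
  -- The exponents are recovered from left to right, cancelling each factor once its exponent is
  -- known.
  have key : ∀ len i, i + len = n → ∀ a b : ℕ → ℕ, (∀ j, a j < m ^ c) → (∀ j, b j < m ^ c) →
      (∀ j, j ∉ I → a j = b j) → φ (tailProd g a i len) = φ (tailProd g b i len) →
      ∀ j, i ≤ j → j < n → a j = b j := by
    intro len
    induction len with
    | zero => intro i hi a b _ _ _ _ j hij hj; omega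
    | succ len ih =>
      intro i hi a b ha hb hI hab
      have hab0 : a i = b i := by
        by_cases hiI : i ∈ I
        · obtain ⟨k, hkc, hkT, hTk⟩ := h.exists_layer hiI
          have hmem : ∀ a, tailProd g a i (len + 1) ∈ Subgroup.upperCentralSeries G (k + 1) :=
            fun a => hTk (tailProd_mem h.antitone h.mem a i (len + 1))
          set x := tailProd g a i (len + 1) * (tailProd g b i (len + 1))⁻¹ with hx
          have hxmem : x ∈ Subgroup.upperCentralSeries G (k + 1) :=
            mul_mem (hmem a) (inv_mem (hmem b))
          have hxker : x ∈ φ.ker := by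
            rw [MonoidHom.mem_ker, hx, map_mul, map_inv, hab, mul_inv_cancel]
          -- Each ψ x lies in ker φ, and (ψ x)^N is short, hence trivial. So x^N drops below the
          -- layer, g i to the power (a i - b i)·N lies in T (i + 1), and infinitude of the factor
          -- gives a i = b i.
          have hxN : x ^ N ∈ Subgroup.upperCentralSeries G k := by
            refine hsep k _ (pow_mem hxmem N) fun ψ hψ => ?_
            have hψd := hdet k ψ hψ
            rw [hψd.pow hxmem]
            refine hker _ ?_ ?_
            · rw [hx, hψd.mul_inv (hmem a) (hmem b)]
              refine wordBall_mono ?_ (hψd.tailProd_mem_wordBall (X := X) (N := N) (M := m ^ c)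
                (R := C₀ * m) (a := a) (b := b) (fun j => ?_)
                (fun j hj => hTk (h.antitone hj (h.mem j))) (len := len + 1)
                fun j hij hj z hz => ?_)
              · rw [mul_assoc]
                exact Nat.mul_le_mul_right _ (by omega)
              · have := ha j
                have := hb j
                omega
              · exact wordBall_mono (Nat.mul_le_mul_right _ (hC₀ k hkc ψ hψ j (by omega)))
                  (hC _ (hψd.center _ (hTk (h.antitone hij (h.mem j)))) m hm z hz)
            · rw [map_pow, (MonoidHom.mem_ker).mp (hψd.normal _ inferInstance x hxker), one_pow]
          have := h.normal (i + 1)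
          have h1 : ∀ a, ((tailProd g a i (len + 1) : G) : G ⧸ T (i + 1)) =
              (g i : G ⧸ T (i + 1)) ^ a i := fun a => by
            rw [tailProd, QuotientGroup.mk_mul, mk_eq_one_of_mem
              (tailProd_mem h.antitone h.mem a (i + 1) len), mul_one, QuotientGroup.mk_pow]
          have h2 : (x : G ⧸ T (i + 1)) = (g i : G ⧸ T (i + 1)) ^ ((a i : ℤ) - b i) := by
            rw [hx, QuotientGroup.mk_mul, QuotientGroup.mk_inv, h1, h1, zpow_sub, zpow_natCast,
              zpow_natCast]
          have h3 := mk_eq_one_of_mem (hkT hxN)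
          rw [QuotientGroup.mk_pow, h2, ← zpow_natCast, ← zpow_mul, ← QuotientGroup.mk_zpow] at h3
          have h4 := h.infinite i hiI _ (mem_of_mk_eq_one h3)
          rcases mul_eq_zero.mp h4 with h5 | h5
          · omega
          · exact absurd (by exact_mod_cast h5) hZ
        · exact hI i hiI
      have hab1 : φ (tailProd g a (i + 1) len) = φ (tailProd g b (i + 1) len) := by
        rw [tailProd, tailProd, map_mul, map_mul, hab0] at hab
        exact mul_left_cancel hab
      intro j hij hj
      rcases hij.eq_or_lt with rfl | hij
      · exact hab0
      · exact ih (i + 1) (by omega) a b ha hb hI hab1 j hij hj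
  have hmc : 0 < m ^ c := pow_pos hm c
  let E : (I → Fin (m ^ c)) → ℕ → ℕ := fun a j => if hj : j ∈ I then a ⟨j, hj⟩ else 0
  have hE : ∀ a j, E a j < m ^ c := fun a j => by
    simp only [E]
    split_ifs
    · exact Fin.is_lt _
    · exact hmc
  have hinj : Function.Injective fun a => φ (tailProd g (E a) 0 n) := by
    intro a b hab
    funext ⟨j, hj⟩
    have h1 := key n 0 (zero_add n) (E a) (E b) (hE a) (hE b)
      (fun j hj => by simp only [E, dif_neg hj]) hab j (Nat.zero_le j)
      (Finset.mem_range.mp (h.subset hj))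
    simp only [E, dif_pos hj] at h1
    exact Fin.ext h1
  have h1 := Nat.card_le_card_of_injective _ hinj
  rw [Nat.card_fun, Nat.card_fin, Nat.card_eq_fintype_card, Fintype.card_coe, ← pow_mul] at h1
  exact h1

end LowerBound

end FullRF

/-! ### Both bounds combined -/

theorem theoremA {G : Type*} [Group G] [Group.FG G] [Group.IsNilpotent G]
    (hZ : (FullRF.lastLowerCentral G).relIndex (Subgroup.center G) ≠ 0) :
    ∀ X : Set G, X.Finite → Subgroup.closure X = ⊤ →
      FullRF.GrowthEquiv (FullRF.fullGrowth X)
        (fun n => n ^ (Group.nilpotencyClass G * FullRF.dim G)) := by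
  intro X hXfin hX
  obtain ⟨n, S, hS, hd⟩ : ∃ (n : ℕ) (S : Fin (n + 1) → Subgroup G),
      FullRF.IsCyclicCentralRefinement G n S ∧ FullRF.numInfiniteFactors S = FullRF.dim G := by
    obtain ⟨n, S, hS⟩ := FullRF.exists_isCyclicCentralRefinement G
    exact Nat.sInf_mem (s := {d : ℕ | ∃ (n : ℕ) (S : Fin (n + 1) → Subgroup G),
      FullRF.IsCyclicCentralRefinement G n S ∧ FullRF.numInfiniteFactors S = d}) ⟨_, n, S, hS, rfl⟩
  obtain ⟨T, g, I, e, h, hI⟩ := hS.exists_cyclicData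
  rw [hd] at hI
  rw [← hI]
  obtain ⟨C, hC⟩ := h.exists_fullyDetects hXfin
  refine ⟨⟨C + 1, Nat.succ_pos C, fun m hm => ?_⟩, ?_⟩
  · obtain ⟨Q, hQ, hQfin, hdet, hcard⟩ := hC m hm
    calc FullRF.fullGrowth X m ≤ Nat.card Q := Nat.sInf_le ⟨Q, hQ, hQfin, hdet, rfl⟩
      _ ≤ C * m ^ (Group.nilpotencyClass G * I.card) := hcard
      _ ≤ (C + 1) * ((C + 1) * m) ^ (Group.nilpotencyClass G * I.card) :=
        Nat.mul_le_mul (Nat.le_succ C)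
          (Nat.pow_le_pow_left (Nat.le_mul_of_pos_left m (Nat.succ_pos C)) _)
  -- The upper bound supplies a finite detecting group, so the infimum is attained and is not the
  -- default 0.
  · have hmin : ∀ m, 0 < m → ∃ (Q : Type) (_ : Group Q), Finite Q ∧
        FullRF.FullyDetects (FullRF.wordBall X m) Q ∧ Nat.card Q = FullRF.fullGrowth X m := by
      intro m hm
      obtain ⟨Q, hQ, hQfin, hdet, -⟩ := hC m hm
      exact Nat.sInf_mem (s := {k : ℕ | ∃ (Q : Type) (_ : Group Q), Finite Q ∧
        FullRF.FullyDetects (FullRF.wordBall X m) Q ∧ Nat.card Q = k}) ⟨_, Q, hQ, hQfin, hdet, rfl⟩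
    -- For class 0 the index c - 1 truncates; the exponent is 0 and only positivity of the order is
    -- needed.
    rcases eq_or_ne (Group.nilpotencyClass G) 0 with hc | hc
    · refine ⟨1, one_pos, fun m hm => ?_⟩
      obtain ⟨Q, hQ, hQfin, -, hcard⟩ := hmin (1 * m) (by omega)
      simp only [hc, zero_mul, pow_zero]
      rw [one_mul, ← hcard]
      exact Nat.card_pos
    · obtain ⟨D, hD⟩ := h.exists_le_card hXfin hX hc hZ
      refine ⟨D + 1, Nat.succ_pos D, fun m hm => ?_⟩
      obtain ⟨Q, hQ, hQfin, ⟨φ, hφ⟩, hcard⟩ := hmin ((D + 1) * m) (Nat.mul_pos (Nat.succ_pos D) hm)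
      have h1 := hD m hm Q ⟨φ, hφ.mono (FullRF.wordBall_mono
        (Nat.mul_le_mul_right m (Nat.le_succ D)))⟩
      rw [hcard] at h1
      exact h1.trans (Nat.le_mul_of_pos_left _ (Nat.succ_pos D))
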